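/- Let $k$ be an algebraically closed field, let $\mathcal C$ be a finite tensor category over $k$ (a rigid monoidal, $k$-linear abelian category with $k$-bilinear tensor product and simple unit object $\mathbf 1$, equivalent as a $k$-linear category to the category of finite-dimensional modules over a finite-dimensional $k$-algebra), and let $\mathcal M$ be an exact left $\mathcal C$-module category (a finite $k$-linear abelian category with a left action $\triangleright$ of $\mathcal C$ that is $k$-bilinear and right exact in each variable, such that $P\triangleright m$ is projective for every projective $P\in\mathcal C$ and every $m\in\mathcal M$). Write $X^*$ for the dual of $X\in\mathcal C$ with evaluation $X^*\otimes X\to\mathbf 1$ and coevaluation $\mathbf 1\to X\otimes X^*$, write ${}^*X$ for the dual on the other side, and let $D=(-)^{**}$, a monoidal endofunctor of $\mathcal C$. For a left $\mathcal C$-module category $\mathcal N$ let ${}_D\mathcal N$ be $\mathcal N$ with the action $(X,n)\mapsto D(X)\triangleright n$; a $D$-twisted $\mathcal C$-module functor $\mathcal M\to\mathcal N$ is a $\mathcal C$-module functor $\mathcal M\to{}_D\mathcal N$. Let $\mathrm{Rex}_{\mathcal C}$ and $\mathrm{Lex}_{\mathcal C}$ denote the categories of $k$-linear right exact, respectively left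 exact, $\mathcal C$-module functors. For every $m\in\mathcal M$ the functor $X\mapsto X\triangleright m$ has a right adjoint $Y_m=[m,-]:\mathcal M\to\mathcal C$ (internal Hom), and every $F\in\mathrm{Rex}_{\mathcal C}(\mathcal M,\mathcal C)$ has a right adjoint $F^{ra}$. Fix any choice of these right adjoints. Each $Y_m$, with its canonical $\mathcal C$-module structure, lies in $\mathrm{Rex}_{\mathcal C}(\mathcal M,\mathcal C)$. The standard relative Serre functor of $\mathcal M$ is the functor $S:\mathcal M\to\mathcal M$, $S(m)=Y_m^{ra}(\mathbf 1)$, together with the natural isomorphism $\phi_{m,n}:[m,n]^*\to[n,S(m)]$ that corresponds, by the Yoneda lemma, to the bijections $$\mathrm{Hom}(X,[m,n]^*)\cong\mathrm{Hom}(X\otimes[m,n],\mathbf 1)\cong\mathrm{Hom}([m,X\triangleright n],\mathbf 1)\cong\mathrm{Hom}(X\triangleright n,Y_m^{ra}(\mathbf 1))\cong\mathrm{Hom}(X,[n,S(m)]).$$ Then there is exactly one structure of a $\mathcal C$-module functor $\mathcal M\to{}_D\mathcal M$ on $S$ for which $\phi$ is an isomorphism of $\mathcal C$-bimodule functors, that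 is, compatible, for all $X\in\mathcal C$ and $m,n\in\mathcal M$, with the left module structures $$X^{**}\otimes[m,n]^*\cong([m,n]\otimes X^*)^*\cong[X\triangleright m,n]^*,\qquad X^{**}\otimes[n,S(m)]\cong[n,X^{**}\triangleright S(m)]\cong[n,S(X\triangleright m)]$$ and with the right module structures $$[m,n]^*\otimes X\cong({}^*X\otimes[m,n])^*\cong[m,{}^*X\triangleright n]^*,\qquad[n,S(m)]\otimes X\cong[{}^*X\triangleright n,S(m)].$$ With this structure, $S$ is equal, as a $D$-twisted $\mathcal C$-module functor, to the composite $$\mathcal M\xrightarrow{\ Y\ }{}_D\bigl(\mathrm{Rex}_{\mathcal C}(\mathcal M,\mathcal C)^{op}\bigr)\xrightarrow{\ (-)^{ra}\ }{}_D\mathrm{Lex}_{\mathcal C}(\mathcal C,\mathcal M)\xrightarrow{\ E\ }{}_D\mathcal M$$ of the following module functors: the internal Yoneda functor $Y(m)=Y_m$, with module structure given by the canonical isomorphism $[m,-]\otimes X^*\cong[X\triangleright m,-]$; the functor taking right adjoints, with module structure given by the canonical isomorphism $F^{ra}(-\otimes X^{**})\cong(F(-)\otimes X^*)^{ra}$;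 and the evaluation $E(G)=G(\mathbf 1)$, with module structure $X\triangleright G(\mathbf 1)\cong G(X)$. Here $X\in\mathcal C$ acts on ${}_D(\mathrm{Rex}_{\mathcal C}(\mathcal M,\mathcal C)^{op})$ by $F\mapsto F(-)\otimes X^*$, and on $\mathrm{Lex}_{\mathcal C}(\mathcal C,\mathcal M)$ by $G\mapsto G(-\otimes X)$. -/

import Mathlib

open CategoryTheory MonoidalCategory Limits
universe w v v' v'' u u' u''
noncomputable section
namespace RelSerre

section Duals

variable {C : Type u} [Category.{v} C] [MonoidalCategory C] [RigidCategory C]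

/-- The dual `X^*`, with evaluation `X^* ⊗ X ⟶ 1` and coevaluation `1 ⟶ X ⊗ X^*`. -/
def dual (X : C) : C := (RightRigidCategory.rightDual X).rightDual

instance dualPairing (X : C) : ExactPairing X (dual X) :=
  (RightRigidCategory.rightDual X).exact

/-- The evaluation `X^* ⊗ X ⟶ 1`. -/
def ev (X : C) : dual X ⊗ X ⟶ 𝟙_ C := ε_ X (dual X)

/-- The dual morphism `f^* : Y^* ⟶ X^*`. -/
def dualMap {X Y : C} (f : X ⟶ Y) : dual Y ⟶ dual X :=
  @rightAdjointMate C _ _ X Y (RightRigidCategory.rightDual X) (RightRigidCategory.rightDual Y) f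

theorem dual_recover {Z X : C} (f : Z ⟶ dual X) :
    f = 𝟙 _ ⊗≫ Z ◁ η_ X (dual X) ⊗≫ (f ▷ X ≫ ev X) ▷ dual X ⊗≫ 𝟙 _ := by
  symm
  calc _ = 𝟙 _ ⊗≫ (Z ◁ η_ X (dual X) ≫ f ▷ (X ⊗ dual X)) ⊗≫ ε_ X (dual X) ▷ dual X ⊗≫ 𝟙 _ := by
        rw [ev]; monoidal
    _ = f ⊗≫ (dual X ◁ η_ X (dual X) ⊗≫ ε_ X (dual X) ▷ dual X) ⊗≫ 𝟙 _ := by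
        rw [whisker_exchange]; monoidal
    _ = _ := by
        rw [ExactPairing.coevaluation_evaluation'']; monoidal

theorem dual_ext {Z X : C} {f g : Z ⟶ dual X} (h : f ▷ X ≫ ev X = g ▷ X ≫ ev X) : f = g := by
  rw [dual_recover f, dual_recover g, h]

theorem dualMap_ev {X Y : C} (f : X ⟶ Y) : dualMap f ▷ X ≫ ev X = dual Y ◁ f ≫ ev Y :=
  @rightAdjointMate_comp_evaluation C _ _ X Y (RightRigidCategory.rightDual X)
    (RightRigidCategory.rightDual Y) f

theorem dualMap_id (X : C) : dualMap (𝟙 X) = 𝟙 (dual X) :=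
  dual_ext (by rw [dualMap_ev]; simp)

theorem dualMap_comp {X Y Z : C} (f : X ⟶ Y) (g : Y ⟶ Z) :
    dualMap (f ≫ g) = dualMap g ≫ dualMap f :=
  dual_ext (by simp [dualMap_ev, ← whisker_exchange_assoc])

/-- The canonical isomorphism `(X ⊗ Y)^* ≅ Y^* ⊗ X^*`. -/
def dualTensor (X Y : C) : dual (X ⊗ Y) ≅ dual Y ⊗ dual X :=
  rightDualIso (dualPairing (X ⊗ Y)) ExactPairing.tensor

/-- The nested evaluation. -/
def evTensor (X Y : C) : (dual Y ⊗ dual X) ⊗ (X ⊗ Y) ⟶ 𝟙_ C :=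
  𝟙 _ ⊗≫ dual Y ◁ (ev X ▷ Y) ⊗≫ ev Y

theorem dualTensor_inv_ev (X Y : C) :
    (dualTensor X Y).inv ▷ (X ⊗ Y) ≫ ev (X ⊗ Y) = evTensor X Y := by
  refine (@rightAdjointMate_comp_evaluation C _ _ (X ⊗ Y) (X ⊗ Y) ⟨dual (X ⊗ Y)⟩
    ⟨dual Y ⊗ dual X⟩ (𝟙 _)).trans ?_
  simp only [MonoidalCategory.whiskerLeft_id, Category.id_comp]
  rfl

/-- The canonical isomorphism `1^* ≅ 1`. -/
def dualUnit : dual (𝟙_ C) ≅ 𝟙_ C := rightDualIso (dualPairing (𝟙_ C)) exactPairingUnit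

theorem dualUnit_inv_ev : (dualUnit (C := C)).inv ▷ (𝟙_ C) ≫ ev (𝟙_ C) = (ρ_ (𝟙_ C)).hom := by
  refine (@rightAdjointMate_comp_evaluation C _ _ (𝟙_ C) (𝟙_ C) ⟨dual (𝟙_ C)⟩
    ⟨𝟙_ C⟩ (𝟙 _)).trans ?_
  simp only [MonoidalCategory.whiskerLeft_id, Category.id_comp]
  rfl

theorem dualTensor_naturality {X X' Y Y' : C} (f : X ⟶ X') (g : Y ⟶ Y') :
    (dualMap g ⊗ₘ dualMap f) ≫ (dualTensor X Y).inv =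
      (dualTensor X' Y').inv ≫ dualMap (f ⊗ₘ g) := by
  apply dual_ext
  simp only [comp_whiskerRight, Category.assoc, dualTensor_inv_ev, dualMap_ev]
  rw [← whisker_exchange_assoc, dualTensor_inv_ev, evTensor, evTensor]
  calc _ = 𝟙 _ ⊗≫ dualMap g ▷ (dual X' ⊗ X ⊗ Y) ⊗≫ dual Y ◁ ((dualMap f ▷ X ≫ ev X) ▷ Y) ⊗≫ ev Y := by
        rw [MonoidalCategory.tensorHom_def]; monoidal
    _ = 𝟙 _ ⊗≫ (dualMap g ▷ ((dual X' ⊗ X) ⊗ Y) ≫ dual Y ◁ ((dual X' ◁ f ≫ ev X') ▷ Y)) ⊗≫ ev Y := by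
        rw [dualMap_ev]; monoidal
    _ = 𝟙 _ ⊗≫ dual Y' ◁ ((dual X' ◁ f ≫ ev X') ▷ Y) ⊗≫ (dualMap g ▷ Y ≫ ev Y) := by
        rw [← whisker_exchange]; monoidal
    _ = 𝟙 _ ⊗≫ dual Y' ◁ (dual X' ◁ (f ▷ Y)) ⊗≫ dual Y' ◁ (ev X' ▷ Y ≫ 𝟙_ C ◁ g) ⊗≫ ev Y' := by
        rw [dualMap_ev]; monoidal
    _ = _ := by
        rw [← whisker_exchange, MonoidalCategory.tensorHom_def]; monoidal

theorem dualTensor_assoc (X Y Z : C) :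
    (dual Z ◁ (dualTensor X Y).inv) ≫ (dualTensor (X ⊗ Y) Z).inv =
      (α_ _ _ _).inv ≫ (dualTensor Y Z).inv ▷ dual X ≫ (dualTensor X (Y ⊗ Z)).inv ≫
        dualMap (α_ X Y Z).hom := by
  apply dual_ext
  simp only [comp_whiskerRight, Category.assoc, dualTensor_inv_ev, dualMap_ev]
  rw [← whisker_exchange_assoc, dualTensor_inv_ev, evTensor, ← whisker_exchange_assoc, evTensor]
  calc _ = 𝟙 _ ⊗≫ dual Z ◁ (((dualTensor X Y).inv ▷ (X ⊗ Y) ≫ ev (X ⊗ Y)) ▷ Z) ⊗≫ ev Z := by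
        monoidal
    _ = 𝟙 _ ⊗≫ ((dual Z ⊗ dual Y) ◁ (ev X ▷ (Y ⊗ Z) ≫ (λ_ _).hom)) ≫ evTensor Y Z := by
        rw [dualTensor_inv_ev, evTensor, evTensor]; monoidal
    _ = 𝟙 _ ⊗≫ ((dual Z ⊗ dual Y) ◁ (ev X ▷ (Y ⊗ Z) ≫ (λ_ _).hom)) ≫ (dualTensor Y Z).inv ▷ (Y ⊗ Z) ≫ ev (Y ⊗ Z) := by
        rw [dualTensor_inv_ev]
    _ = _ := by
        rw [whisker_exchange_assoc]; monoidal

theorem dualTensor_unit_left (X : C) :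
    dual X ◁ (dualUnit (C := C)).inv ≫ (dualTensor (𝟙_ C) X).inv =
      (ρ_ _).hom ≫ dualMap (λ_ X).hom := by
  apply dual_ext
  simp only [comp_whiskerRight, Category.assoc, dualTensor_inv_ev, dualMap_ev]
  rw [← whisker_exchange_assoc, evTensor]
  calc _ = 𝟙 _ ⊗≫ dual X ◁ (((dualUnit (C := C)).inv ▷ (𝟙_ C) ≫ ev (𝟙_ C)) ▷ X) ⊗≫ ev X := by
        monoidal
    _ = _ := by rw [dualUnit_inv_ev]; monoidal

theorem dualTensor_unit_right (X : C) :
    (dualUnit (C := C)).inv ▷ dual X ≫ (dualTensor X (𝟙_ C)).inv =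
      (λ_ _).hom ≫ dualMap (ρ_ X).hom := by
  apply dual_ext
  simp only [comp_whiskerRight, Category.assoc, dualTensor_inv_ev, dualMap_ev]
  rw [← whisker_exchange_assoc, evTensor]
  calc _ = 𝟙 _ ⊗≫ ((dualUnit (C := C)).inv ▷ ((dual X ⊗ X) ⊗ 𝟙_ C) ≫
          dual (𝟙_ C) ◁ (ev X ▷ 𝟙_ C)) ⊗≫ ev (𝟙_ C) := by
        monoidal
    _ = 𝟙 _ ⊗≫ (ev X ▷ 𝟙_ C) ⊗≫ ((dualUnit (C := C)).inv ▷ (𝟙_ C) ≫ ev (𝟙_ C)) := by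
        rw [← whisker_exchange]; monoidal
    _ = _ := by rw [dualUnit_inv_ev]; monoidal

/-- The dual of an isomorphism. -/
def dualMapIso {X Y : C} (e : X ≅ Y) : dual Y ≅ dual X where
  hom := dualMap e.hom
  inv := dualMap e.inv
  hom_inv_id := by rw [← dualMap_comp, e.inv_hom_id, dualMap_id]
  inv_hom_id := by rw [← dualMap_comp, e.hom_inv_id, dualMap_id]

/-- The double dual functor `(-)^**`. -/
@[simps]
def doubleDual (C : Type u) [Category.{v} C] [MonoidalCategory C] [RigidCategory C] : C ⥤ C where
  obj X := dual (dual X)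
  map f := dualMap (dualMap f)
  map_id X := by rw [dualMap_id, dualMap_id]
  map_comp f g := by rw [dualMap_comp, dualMap_comp]

theorem dualTensor_naturality_left {X X' : C} (f : X ⟶ X') (Y : C) :
    (dual Y ◁ dualMap f) ≫ (dualTensor X Y).inv = (dualTensor X' Y).inv ≫ dualMap (f ▷ Y) := by
  have := dualTensor_naturality f (𝟙 Y)
  simpa [dualMap_id] using this

theorem dualTensor_naturality_right (X : C) {Y Y' : C} (g : Y ⟶ Y') :
    (dualMap g ▷ dual X) ≫ (dualTensor X Y).inv = (dualTensor X Y').inv ≫ dualMap (X ◁ g) := by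
  have := dualTensor_naturality (𝟙 X) g
  simpa [dualMap_id] using this

theorem dualTensor_hom_naturality_left {X X' : C} (f : X ⟶ X') (Y : C) :
    dualMap (f ▷ Y) ≫ (dualTensor X Y).hom = (dualTensor X' Y).hom ≫ (dual Y ◁ dualMap f) := by
  rw [Iso.eq_comp_inv (dualTensor X Y) |>.symm, Category.assoc, dualTensor_naturality_left,
    Iso.hom_inv_id_assoc]

theorem dualTensor_hom_naturality_right (X : C) {Y Y' : C} (g : Y ⟶ Y') :
    dualMap (X ◁ g) ≫ (dualTensor X Y).hom = (dualTensor X Y').hom ≫ (dualMap g ▷ dual X) := by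
  rw [Iso.eq_comp_inv (dualTensor X Y) |>.symm, Category.assoc, dualTensor_naturality_right,
    Iso.hom_inv_id_assoc]

theorem dualTensor_assoc_hom (X Y Z : C) :
    dualMap (α_ X Y Z).hom ≫ (dualTensor (X ⊗ Y) Z).hom ≫ (dual Z ◁ (dualTensor X Y).hom) =
      (dualTensor X (Y ⊗ Z)).hom ≫ (dualTensor Y Z).hom ▷ dual X ≫ (α_ _ _ _).hom := by
  have h : dualMap (α_ X Y Z).hom = (dualTensor X (Y ⊗ Z)).hom ≫ (dualTensor Y Z).hom ▷ dual X ≫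
      (α_ _ _ _).hom ≫ dual Z ◁ (dualTensor X Y).inv ≫ (dualTensor (X ⊗ Y) Z).inv := by
    rw [dualTensor_assoc]; simp
  rw [h]; simp

/-- The tensor constraint `X^** ⊗ Y^** ≅ (X ⊗ Y)^**`. -/
def doubleDualTensor (X Y : C) : dual (dual X) ⊗ dual (dual Y) ≅ dual (dual (X ⊗ Y)) :=
  (dualTensor (dual Y) (dual X)).symm ≪≫ dualMapIso (dualTensor X Y)

/-- The unit constraint `1 ≅ 1^**`. -/
def doubleDualUnit : 𝟙_ C ≅ dual (dual (𝟙_ C)) := dualUnit.symm ≪≫ dualMapIso dualUnit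

theorem doubleDualTensor_hom (X Y : C) : (doubleDualTensor X Y).hom =
    (dualTensor (dual Y) (dual X)).inv ≫ dualMap (dualTensor X Y).hom := rfl

theorem doubleDualUnit_hom : (doubleDualUnit (C := C)).hom =
    dualUnit.inv ≫ dualMap dualUnit.hom := rfl

theorem doubleDualTensor_natural_left {X X' : C} (f : X ⟶ X') (Y : C) :
    dualMap (dualMap f) ▷ dual (dual Y) ≫ (doubleDualTensor X' Y).hom =
      (doubleDualTensor X Y).hom ≫ dualMap (dualMap (f ▷ Y)) := by
  simp only [doubleDualTensor_hom, Category.assoc, ← dualMap_comp]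
  rw [← Category.assoc, dualTensor_naturality_right, Category.assoc, ← dualMap_comp,
    dualTensor_hom_naturality_left]

theorem doubleDualTensor_natural_right (X : C) {Y Y' : C} (f : Y ⟶ Y') :
    dual (dual X) ◁ dualMap (dualMap f) ≫ (doubleDualTensor X Y').hom =
      (doubleDualTensor X Y).hom ≫ dualMap (dualMap (X ◁ f)) := by
  simp only [doubleDualTensor_hom, Category.assoc, ← dualMap_comp]
  rw [← Category.assoc, dualTensor_naturality_left, Category.assoc, ← dualMap_comp,
    dualTensor_hom_naturality_right]

theorem doubleDualTensor_assoc (X Y Z : C) :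
    (doubleDualTensor X Y).hom ▷ dual (dual Z) ≫ (doubleDualTensor (X ⊗ Y) Z).hom ≫
        dualMap (dualMap (α_ X Y Z).hom) =
      (α_ _ _ _).hom ≫ dual (dual X) ◁ (doubleDualTensor Y Z).hom ≫
        (doubleDualTensor X (Y ⊗ Z)).hom := by
  have h1 := dualTensor_naturality_right (dual Z) (dualTensor X Y).hom
  have h2 := dualTensor_naturality_left (dualTensor Y Z).hom (dual X)
  have h3 := dualTensor_assoc (dual Z) (dual Y) (dual X)
  have h4 := congrArg dualMap (dualTensor_assoc_hom X Y Z)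
  simp only [dualMap_comp, Category.assoc] at h4
  simp only [doubleDualTensor_hom, comp_whiskerRight, MonoidalCategory.whiskerLeft_comp,
    Category.assoc]
  rw [reassoc_of% h1, h4, reassoc_of% h2, reassoc_of% h3]
  simp

theorem dualUnit_left (X : C) : (λ_ (dual (dual X))).hom =
    (doubleDualUnit (C := C)).hom ▷ dual (dual X) ≫ (doubleDualTensor (𝟙_ C) X).hom ≫
      dualMap (dualMap (λ_ X).hom) := by
  have h1 := dualTensor_naturality_right (dual X) (dualUnit (C := C)).hom
  have h2 := dualTensor_unit_right (dual X)
  have h3 : dualMap (λ_ X).hom ≫ (dualTensor (𝟙_ C) X).hom ≫ dual X ◁ (dualUnit (C := C)).hom =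
      (ρ_ _).inv := by
    rw [Iso.eq_inv_comp _ |>.2 (dualTensor_unit_left X).symm]; simp
  simp only [doubleDualTensor_hom, doubleDualUnit_hom, comp_whiskerRight, Category.assoc]
  rw [reassoc_of% h1, ← dualMap_comp, ← dualMap_comp, Category.assoc, h3, reassoc_of% h2,
    ← dualMap_comp]
  simp [dualMap_id]

theorem dualUnit_right (X : C) : (ρ_ (dual (dual X))).hom =
    dual (dual X) ◁ (doubleDualUnit (C := C)).hom ≫ (doubleDualTensor X (𝟙_ C)).hom ≫
      dualMap (dualMap (ρ_ X).hom) := by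
  have h1 := dualTensor_naturality_left (dualUnit (C := C)).hom (dual X)
  have h2 := dualTensor_unit_left (dual X)
  have h3 : dualMap (ρ_ X).hom ≫ (dualTensor X (𝟙_ C)).hom ≫ (dualUnit (C := C)).hom ▷ dual X =
      (λ_ _).inv := by
    rw [Iso.eq_inv_comp _ |>.2 (dualTensor_unit_right X).symm]; simp
  simp only [doubleDualTensor_hom, doubleDualUnit_hom, MonoidalCategory.whiskerLeft_comp,
    Category.assoc]
  rw [reassoc_of% h1, ← dualMap_comp, ← dualMap_comp, Category.assoc, h3, reassoc_of% h2,
    ← dualMap_comp]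
  simp [dualMap_id]

/-- The monoidal structure of the double dual functor. -/
def doubleDualCore : (doubleDual C).CoreMonoidal where
  εIso := doubleDualUnit
  μIso X Y := doubleDualTensor X Y
  μIso_hom_natural_left f Z := doubleDualTensor_natural_left f Z
  μIso_hom_natural_right Z f := doubleDualTensor_natural_right Z f
  associativity X Y Z := doubleDualTensor_assoc X Y Z
  left_unitality X := dualUnit_left X
  right_unitality X := dualUnit_right X

instance : (doubleDual C).Monoidal := doubleDualCore.toMonoidal

end Duals

section Actions

open MonoidalLeftAction Functor.LaxMonoidal Functor.OplaxMonoidal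

variable {C : Type u} [Category.{v} C] [MonoidalCategory C]

section
variable (F : C ⥤ C) [F.Monoidal] {M : Type u'} [Category.{v'} M] [MonoidalLeftAction C M]

/-- The associativity constraint of the twisted action. -/
def twistAssoc (X Y : C) (m : M) : F.obj (X ⊗ Y) ⊙ₗ m ≅ F.obj X ⊙ₗ F.obj Y ⊙ₗ m where
  hom := δ F X Y ⊵ₗ m ≫ (αₗ _ _ _).hom
  inv := (αₗ _ _ _).inv ≫ μ F X Y ⊵ₗ m
  hom_inv_id := by simp [← MonoidalLeftAction.comp_actionHomLeft]
  inv_hom_id := by simp [← MonoidalLeftAction.comp_actionHomLeft_assoc]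

/-- The unit constraint of the twisted action. -/
def twistUnit (m : M) : F.obj (𝟙_ C) ⊙ₗ m ≅ m where
  hom := η F ⊵ₗ m ≫ (λₗ _).hom
  inv := (λₗ _).inv ≫ ε F ⊵ₗ m
  hom_inv_id := by simp [← MonoidalLeftAction.comp_actionHomLeft]
  inv_hom_id := by simp [← MonoidalLeftAction.comp_actionHomLeft_assoc]

variable (M) in
/-- The action `(X, m) ↦ F X ⊙ₗ m`, for a monoidal endofunctor `F` of `C`. -/
abbrev twistActionAux : MonoidalLeftAction C M where
  actionObj X m := F.obj X ⊙ₗ m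
  actionHomLeft f m := F.map f ⊵ₗ m
  actionHomRight X _ _ g := F.obj X ⊴ₗ g
  actionAssocIso X Y m := twistAssoc F X Y m
  actionUnitIso m := twistUnit F m
  actionHom_def _ _ := rfl
  actionHomRight_id X m := by simp
  id_actionHomLeft X m := by simp
  actionHom_comp f₁ f₂ g₁ g₂ := by
    simp [action_exchange_assoc]
  actionAssocIso_hom_naturality {_ _ c₃ _ d₁ _} f g h := by
    dsimp only [twistAssoc]
    have e : F.map (f ⊗ₘ g) ≫ δ F _ _ = δ F _ _ ≫ (F.map f ⊗ₘ F.map g) := by simp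
    have h0 := actionAssocIso_hom_naturality (F.map f) (F.map g) h
    have h1 := congrArg (fun t => t ⊵ₗ d₁) e
    simp only [MonoidalLeftAction.comp_actionHomLeft] at h1
    simp only [MonoidalLeftAction.actionHom_def, Category.assoc] at h0
    simp only [Category.assoc]
    rw [← h0, ← reassoc_of% h1, MonoidalLeftAction.action_exchange_assoc]
  actionUnitIso_hom_naturality f := by
    dsimp only [twistUnit]
    rw [MonoidalLeftAction.action_exchange_assoc, Category.assoc,
      MonoidalLeftAction.actionUnitIso_hom_naturality]
  whiskerLeft_actionHomLeft c _ _ f d := by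
    dsimp only [twistAssoc]
    rw [Functor.Monoidal.map_whiskerLeft]
    simp only [MonoidalLeftAction.comp_actionHomLeft,
      MonoidalLeftAction.whiskerLeft_actionHomLeft, Category.assoc]
  whiskerRight_actionHomLeft c f d := by
    dsimp only [twistAssoc]
    rw [Functor.Monoidal.map_whiskerRight]
    simp only [MonoidalLeftAction.comp_actionHomLeft,
      MonoidalLeftAction.whiskerRight_actionHomLeft, Category.assoc]
  associator_actionHom c₁ c₂ c₃ d := by
    dsimp only [twistAssoc]
    have h := congrArg (fun t => t ⊵ₗ d ≫ (αₗ _ _ _).hom ≫ F.obj c₁ ⊴ₗ (αₗ _ _ d).hom)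
      (Functor.OplaxMonoidal.associativity F c₁ c₂ c₃)
    simp only [MonoidalLeftAction.comp_actionHomLeft, Category.assoc] at h
    simpa using h.symm
  leftUnitor_actionHom c d := by
    dsimp only [twistAssoc, twistUnit]
    have h := congrArg (fun t => t ⊵ₗ d) (Functor.OplaxMonoidal.left_unitality_hom F c)
    simp only [MonoidalLeftAction.comp_actionHomLeft] at h
    rw [← h]
    simp [-Functor.LaxMonoidal.left_unitality]
  rightUnitor_actionHom c d := by
    dsimp only [twistAssoc, twistUnit]
    have h := congrArg (fun t => t ⊵ₗ d) (Functor.OplaxMonoidal.right_unitality_hom F c)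
    simp only [MonoidalLeftAction.comp_actionHomLeft] at h
    rw [← h]
    simp [-Functor.LaxMonoidal.right_unitality]
end

/-- The category `M` with the action twisted along `F`: `X` acts on `Twist F M` as `F X` acts
on `M`. -/
def Twist (_F : C ⥤ C) (M : Type u') := M

instance (F : C ⥤ C) (M : Type u') [Category.{v'} M] : Category.{v'} (Twist F M) :=
  inferInstanceAs (Category M)

instance twistAction (F : C ⥤ C) [F.Monoidal] (M : Type u')
    [Category.{v'} M] [MonoidalLeftAction C M] :
    MonoidalLeftAction C (Twist F M) :=
  twistActionAux F M

end Actions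

section DualOp

open MonoidalRightAction

variable {C : Type u} [Category.{v} C] [MonoidalCategory C] [RigidCategory C]
  {R : Type u'} [Category.{v'} R] [MonoidalRightAction C R]

/-- The associativity constraint of the action `(X, F) ↦ F ⊙ᵣ X^*`. -/
def dualActAssoc (X Y : C) (F : R) : F ⊙ᵣ dual (X ⊗ Y) ≅ (F ⊙ᵣ dual Y) ⊙ᵣ dual X where
  hom := F ⊴ᵣ (dualTensor X Y).hom ≫ (αᵣ F (dual Y) (dual X)).hom
  inv := (αᵣ F (dual Y) (dual X)).inv ≫ F ⊴ᵣ (dualTensor X Y).inv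
  hom_inv_id := by simp [← MonoidalRightAction.actionHomRight_comp]
  inv_hom_id := by simp [← MonoidalRightAction.actionHomRight_comp_assoc]

/-- The unit constraint of the action `(X, F) ↦ F ⊙ᵣ X^*`. -/
def dualActUnit (F : R) : F ⊙ᵣ dual (𝟙_ C) ≅ F where
  hom := F ⊴ᵣ dualUnit.hom ≫ (ρᵣ F).hom
  inv := (ρᵣ F).inv ≫ F ⊴ᵣ dualUnit.inv
  hom_inv_id := by simp [← MonoidalRightAction.actionHomRight_comp]
  inv_hom_id := by simp [← MonoidalRightAction.actionHomRight_comp_assoc]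

variable (C R) in
/-- The opposite of a right module category `R`, with the left action `(X, F) ↦ F ⊙ᵣ X^*`. This is
the twist along `(-)^**` of the left action `(X, F) ↦ F ⊙ᵣ ^*X` on the opposite category. -/
def DualOp (_C : Type u) (R : Type u') := Rᵒᵖ

instance (C : Type u) (R : Type u') [Category.{v'} R] : Category.{v'} (DualOp C R) :=
  inferInstanceAs (Category Rᵒᵖ)

open Opposite

variable (C R) in
/-- The left action `(X, F) ↦ F ⊙ᵣ X^*` of `C` on the opposite of a right module category. -/
abbrev dualOpActionAux : MonoidalLeftAction C Rᵒᵖ where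
  actionObj X F := op (unop F ⊙ᵣ dual X)
  actionHomLeft f F := (unop F ⊴ᵣ dualMap f).op
  actionHomRight X _ _ g := (g.unop ⊵ᵣ dual X).op
  actionAssocIso X Y F := (dualActAssoc X Y (unop F)).symm.op
  actionUnitIso F := (dualActUnit (C := C) (unop F)).symm.op
  actionHom_def _ _ := rfl
  actionHomRight_id X m := by simp
  id_actionHomLeft X m := by simp [dualMap_id]
  actionHom_comp f₁ f₂ g₁ g₂ := by
    apply Quiver.Hom.unop_inj
    dsimp
    simp [dualMap_comp, MonoidalRightAction.action_exchange_assoc]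
  actionAssocIso_hom_naturality {_ _ _ _ d₁ _} f g h := by
    apply Quiver.Hom.unop_inj
    dsimp only [dualActAssoc]
    have e0 := dualTensor_naturality f g
    rw [MonoidalCategory.tensorHom_def (dualMap g) (dualMap f)] at e0
    have e := congrArg (fun t => unop d₁ ⊴ᵣ t) e0
    simp only [Category.assoc, actionHomRight_comp] at e
    simp only [unop_comp, Quiver.Hom.unop_op, Iso.op_hom, Iso.symm_hom, Category.assoc,
      MonoidalRightAction.comp_actionHomLeft, actionHomRight_comp]
    simp only [MonoidalRightAction.action_exchange_assoc, Category.assoc]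
    rw [← e]
    simp [MonoidalRightAction.action_exchange_assoc]
  actionUnitIso_hom_naturality {d d'} f := by
    apply Quiver.Hom.unop_inj
    dsimp only [dualActUnit]
    simp
    rw [MonoidalRightAction.action_exchange]
    simp
  whiskerLeft_actionHomLeft c d₁ d₂ f d := by
    apply Quiver.Hom.unop_inj
    dsimp [dualActAssoc]
    have e : dualMap (c ◁ f) = (dualTensor c d₂).hom ≫ dualMap f ▷ dual c ≫
        (dualTensor c d₁).inv := by rw [dualTensor_naturality_right]; simp
    rw [e]
    simp
  whiskerRight_actionHomLeft {c₁ c₂} c f d := by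
    apply Quiver.Hom.unop_inj
    dsimp [dualActAssoc]
    have e : dualMap (f ▷ c) = (dualTensor c₂ c).hom ≫ dual c ◁ dualMap f ≫
        (dualTensor c₁ c).inv := by rw [dualTensor_naturality_left]; simp
    rw [e]
    simp
  associator_actionHom c₁ c₂ c₃ d := by
    apply Quiver.Hom.unop_inj
    dsimp [dualActAssoc]
    have e := congrArg (fun t => unop d ⊴ᵣ t) (dualTensor_assoc c₁ c₂ c₃)
    simp only [Category.assoc, actionHomRight_comp] at e
    have a := actionHom_associator (dual c₃) (dual c₂) (dual c₁) (unop d)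
    have a' : unop d ⊴ᵣ (α_ (dual c₃) (dual c₂) (dual c₁)).inv =
      (αᵣ _ _ _).hom ≫ (αᵣ _ _ _).hom ≫ (αᵣ _ _ _).inv ⊵ᵣ _ ≫ (αᵣ _ _ _).inv := by
      rw [← cancel_epi (unop d ⊴ᵣ (α_ (dual c₃) (dual c₂) (dual c₁)).hom), reassoc_of% a]
      simp [← MonoidalRightAction.comp_actionHomLeft_assoc, ← actionHomRight_comp]
    rw [a'] at e
    simp [e]
  leftUnitor_actionHom c d := by
    apply Quiver.Hom.unop_inj
    dsimp [dualActAssoc, dualActUnit]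
    have e : dualMap (λ_ c).hom = (ρ_ _).inv ≫ dual c ◁ dualUnit.inv ≫
      (dualTensor (𝟙_ C) c).inv := by rw [dualTensor_unit_left]; simp
    have a : unop d ⊴ᵣ (ρ_ (dual c)).inv = (ρᵣ _).inv ≫ (αᵣ _ _ _).inv := by
      rw [← cancel_epi (unop d ⊴ᵣ (ρ_ (dual c)).hom), ← actionHomRight_comp]
      simp
    rw [e, actionHomRight_comp, a]
    simp
  rightUnitor_actionHom c d := by
    apply Quiver.Hom.unop_inj
    dsimp [dualActAssoc, dualActUnit]
    have e : dualMap (ρ_ c).hom = (λ_ _).inv ≫ dualUnit.inv ▷ dual c ≫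
      (dualTensor c (𝟙_ C)).inv := by rw [dualTensor_unit_right]; simp
    have a : unop d ⊴ᵣ (λ_ (dual c)).inv = (ρᵣ _).inv ⊵ᵣ _ ≫ (αᵣ _ _ _).inv := by
      rw [← cancel_epi (unop d ⊴ᵣ (λ_ (dual c)).hom), ← actionHomRight_comp]
      simp [← MonoidalRightAction.comp_actionHomLeft_assoc]
    rw [e, actionHomRight_comp, a]
    simp

instance dualOpAction : MonoidalLeftAction C (DualOp C R) := dualOpActionAux C R

end DualOp

section FiniteCategories

open MonoidalLeftAction

/-- A `k`-linear abelian category that is `k`-linearly equivalent to the category of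
finite-dimensional left modules over some finite-dimensional `k`-algebra. -/
class FiniteAbelian (k : Type w) [Field k] (A : Type u) [Category.{v} A] [Abelian A]
    [Linear k A] : Prop where
  exists_equivalence : ∃ (B : Type w) (_ : Ring B) (_ : Algebra k B) (_ : Module.Finite k B)
    (e : A ≌ FGModuleCat.{w} B), e.functor.Additive ∧ Functor.Linear k e.functor

theorem fgModule_surjective {B : Type w} [Ring B] {E X : FGModuleCat.{w} B} (f : E ⟶ X) [Epi f] :
    Function.Surjective f.hom.hom := by
  let p : X.obj →ₗ[B] (X.obj ⧸ LinearMap.range f.hom.hom) := (LinearMap.range f.hom.hom).mkQ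
  let P : X ⟶ FGModuleCat.of B (X.obj ⧸ LinearMap.range f.hom.hom) :=
    ⟨ModuleCat.ofHom p⟩
  have h : f ≫ P = f ≫ 0 := by
    ext x
    simp [P, p]
  have h2 := (cancel_epi f).1 h
  rw [← LinearMap.range_eq_top, ← Submodule.ker_mkQ (LinearMap.range f.hom.hom)]
  rw [LinearMap.ker_eq_top]
  exact congrArg (fun t => t.hom.hom) h2

theorem enoughProjectives_fgModule (B : Type w) [Ring B] :
    EnoughProjectives (FGModuleCat.{w} B) where
  presentation X := by
    obtain ⟨n, g, hg⟩ := Module.Finite.exists_fin' B X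
    refine ⟨{ p := FGModuleCat.of B (Fin n → B), f := ⟨ModuleCat.ofHom g⟩, projective := ?_, epi := ?_ }⟩
    · refine ⟨fun {E Y} f e _ => ?_⟩
      have he := fgModule_surjective e
      obtain ⟨l, hl⟩ := Module.projective_lifting_property e.hom.hom f.hom.hom he
      exact ⟨⟨ModuleCat.ofHom l⟩, FGModuleCat.hom_ext hl⟩
    · refine ⟨fun {Z} a b h => FGModuleCat.hom_ext ?_⟩
      ext x
      obtain ⟨y, rfl⟩ := hg x
      exact congrArg (fun t => t.hom.hom y) h

theorem enoughProjectives (k : Type w) [Field k] (A : Type u) [Category.{v} A] [Abelian A]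
    [Linear k A] [FiniteAbelian k A] : EnoughProjectives A := by
  obtain ⟨B, _, _, _, e, _⟩ := FiniteAbelian.exists_equivalence (k := k) (A := A)
  exact (Equivalence.enoughProjectives_iff e).2 (enoughProjectives_fgModule B)

/-- A finite tensor category: a rigid monoidal finite abelian category with bilinear
tensor product and simple unit object. -/
class FiniteTensorCategory (k : Type w) [Field k] (C : Type u) [Category.{v} C] [Abelian C]
    [Linear k C] [MonoidalCategory C] [MonoidalPreadditive C] [MonoidalLinear k C]
    [RigidCategory C] : Prop extends FiniteAbelian k C where
  simple_unit : Simple (𝟙_ C)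

/-- An exact module category: a finite abelian category with a left action of `C`, bilinear and
right exact in each variable, such that projective objects of `C` act on every object with
projective values. -/
class ExactModuleCategory (k : Type w) [Field k] (C : Type u) [Category.{v} C] [Abelian C]
    [Linear k C] [MonoidalCategory C] (M : Type u') [Category.{v'} M] [Abelian M]
    [Linear k M] [MonoidalLeftAction C M] : Prop extends FiniteAbelian k M where
  actionLeft_additive (X : C) : (MonoidalLeftAction.actionLeft M X).Additive
  actionLeft_linear (X : C) : (MonoidalLeftAction.actionLeft M X).Linear k
  actionLeft_rightExact (X : C) : PreservesFiniteColimits (MonoidalLeftAction.actionLeft M X)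
  actionRight_additive (m : M) : (MonoidalLeftAction.actionRight C m).Additive
  actionRight_linear (m : M) : (MonoidalLeftAction.actionRight C m).Linear k
  actionRight_rightExact (m : M) : PreservesFiniteColimits (MonoidalLeftAction.actionRight C m)
  projective_action (P : C) (m : M) : Projective P → Projective (P ⊙ₗ m)

end FiniteCategories

section ModuleFunctors

open Functor.LaxLeftLinear MonoidalLeftAction

variable {C : Type u} [Category.{v} C] [MonoidalCategory C]
  {M : Type u'} [Category.{v'} M] [MonoidalLeftAction C M]
  {N : Type u''} [Category.{v''} N] [MonoidalLeftAction C N]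

theorem assoc_natR (X Y : C) {n n' : N} (f : n ⟶ n') :
    (αₗ X Y n).hom ≫ X ⊴ₗ Y ⊴ₗ f = (X ⊗ Y) ⊴ₗ f ≫ (αₗ X Y n').hom := by simp

theorem assoc_natL {X X' : C} (f : X ⟶ X') (Y : C) (n : N) :
    (αₗ X Y n).hom ≫ f ⊵ₗ (Y ⊙ₗ n) = (f ▷ Y) ⊵ₗ n ≫ (αₗ X' Y n).hom := by simp

theorem assoc_natM (X : C) {Y Y' : C} (f : Y ⟶ Y') (n : N) :
    (αₗ X Y n).hom ≫ X ⊴ₗ f ⊵ₗ n = (X ◁ f) ⊵ₗ n ≫ (αₗ X Y' n).hom := by simp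

/-- Auxiliary inverse to the lineator of a lax module functor. -/
def lineatorInv [RigidCategory C] (F : M ⥤ N) [F.LaxLeftLinear C] (X : C) (m : M) :
    F.obj (X ⊙ₗ m) ⟶ X ⊙ₗ F.obj m :=
  (λₗ[C] _).inv ≫ η_ X (dual X) ⊵ₗ _ ≫ (αₗ _ _ _).hom ≫
    X ⊴ₗ (μₗ F (dual X) (X ⊙ₗ m) ≫ F.map ((αₗ _ _ _).inv ≫ ev X ⊵ₗ m ≫ (λₗ[C] m).hom))

theorem zigzag_action [RigidCategory C] (X : C) (n : N) :
    (λₗ[C] (X ⊙ₗ n)).inv ≫ η_ X (dual X) ⊵ₗ (X ⊙ₗ n) ≫ (αₗ _ _ _).hom ≫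
      X ⊴ₗ ((αₗ _ _ _).inv ≫ ev X ⊵ₗ n ≫ (λₗ[C] n).hom) = 𝟙 _ := by
  have h := congrArg (fun t => t ⊵ₗ n) (ExactPairing.evaluation_coevaluation X (dual X))
  simp only [MonoidalLeftAction.comp_actionHomLeft] at h
  simp only [MonoidalLeftAction.whiskerRight_actionHomLeft,
    MonoidalLeftAction.whiskerLeft_actionHomLeft, MonoidalLeftAction.leftUnitor_actionHom,
    Category.assoc] at h
  have a : (αₗ X (dual X) (X ⊙ₗ n)).hom ≫ X ⊴ₗ (αₗ (dual X) X n).inv =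
      (αₗ _ _ _).inv ≫ (α_ X (dual X) X).hom ⊵ₗ n ≫ (αₗ X (dual X ⊗ X) n).hom := by
    rw [Iso.eq_inv_comp, ← associator_actionHom_assoc, ← cancel_mono (X ⊴ₗ (αₗ (dual X) X n).hom)]
    simp
  have b : X ⊴ₗ (λₗ[C] n).hom = (αₗ X (𝟙_ C) n).inv ≫ (ρ_ X).hom ⊵ₗ n := by simp
  simp only [MonoidalLeftAction.actionHomRight_comp]
  rw [reassoc_of% a, b, Iso.inv_comp_eq, Category.comp_id,
    ← cancel_mono ((ρ_ X).inv ⊵ₗ n)]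
  rw [← cancel_epi (αₗ (𝟙_ C) X n).hom]
  simp only [Category.assoc]
  simp only [← h]
  simp only [← MonoidalLeftAction.comp_actionHomLeft, Iso.hom_inv_id]
  simp [ev]

theorem lineator_comp_inv [RigidCategory C] (F : M ⥤ N) [F.LaxLeftLinear C] (X : C) (m : M) :
    μₗ F X m ≫ lineatorInv F X m = 𝟙 _ := by
  have h : (αₗ (dual X) X (F.obj m)).inv ≫ ev X ⊵ₗ (F.obj m) ≫ (λₗ[C] (F.obj m)).hom =
      dual X ⊴ₗ μₗ F X m ≫ μₗ F (dual X) (X ⊙ₗ m) ≫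
        F.map ((αₗ _ _ _).inv ≫ ev X ⊵ₗ m ≫ (λₗ[C] m).hom) := by
    simp only [Functor.map_comp]
    rw [μₗ_associativity_inv_assoc, ← μₗ_naturality_left_assoc, μₗ_unitality]
  rw [← zigzag_action X (F.obj m), h, lineatorInv]
  simp only [MonoidalLeftAction.actionHomRight_comp]
  rw [reassoc_of% assoc_natR, ← MonoidalLeftAction.action_exchange_assoc,
    actionUnitIso_inv_naturality_assoc]

theorem inv_comp_lineator [RigidCategory C] (F : M ⥤ N) [F.LaxLeftLinear C] (X : C) (m : M) :
    lineatorInv F X m ≫ μₗ F X m = 𝟙 _ := by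
  have h := congrArg F.map (zigzag_action X m)
  rw [CategoryTheory.Functor.map_id] at h
  rw [lineatorInv, ← h]
  rw [MonoidalLeftAction.actionHomRight_comp]
  simp only [Category.assoc]
  rw [μₗ_naturality_right, ← μₗ_associativity_assoc, μₗ_naturality_left_assoc,
    μₗ_unitality_inv_assoc]
  simp only [← Functor.map_comp]

theorem isIso_lineator [RigidCategory C] (F : M ⥤ N) [F.LaxLeftLinear C] (X : C) (m : M) :
    IsIso (μₗ F X m) :=
  ⟨lineatorInv F X m, lineator_comp_inv F X m, inv_comp_lineator F X m⟩

variable (C M N) in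
/-- A `C`-module functor: a functor with an invertible lineator
`X ⊙ₗ F m ⟶ F (X ⊙ₗ m)`. -/
structure ModuleFunctor where
  functor : M ⥤ N
  lax : functor.LaxLeftLinear C
  isIso (X : C) (m : M) : IsIso (μₗ functor X m)

end ModuleFunctors

section ModuleFunctorCategories

open Functor.LaxLeftLinear MonoidalLeftAction

attribute [instance] ModuleFunctor.lax ModuleFunctor.isIso

variable {C : Type u} [Category.{v} C] [MonoidalCategory C]
  {M : Type u'} [Category.{v'} M] [MonoidalLeftAction C M]
  {N : Type u''} [Category.{v''} N] [MonoidalLeftAction C N]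

/-- Morphisms of `C`-module functors: natural transformations compatible with the lineators. -/
@[ext]
structure ModuleFunctor.Hom (F G : ModuleFunctor C M N) where
  nat : F.functor ⟶ G.functor
  comm (X : C) (m : M) :
    μₗ F.functor X m ≫ nat.app (X ⊙ₗ m) = X ⊴ₗ nat.app m ≫ μₗ G.functor X m

/-- The identity morphism. -/
@[simps]
def ModuleFunctor.Hom.id (F : ModuleFunctor C M N) : ModuleFunctor.Hom F F where
  nat := 𝟙 _
  comm X m := by simp

/-- Composition of morphisms. -/
@[simps]
def ModuleFunctor.Hom.comp {F G H : ModuleFunctor C M N} (a : ModuleFunctor.Hom F G)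
    (b : ModuleFunctor.Hom G H) : ModuleFunctor.Hom F H where
  nat := a.nat ≫ b.nat
  comm X m := by simp [reassoc_of% a.comm, b.comm]

/-- The composite lineator. -/
abbrev laxComp {P : Type*} [Category* P] [MonoidalLeftAction C P] (F : M ⥤ N) (G : N ⥤ P)
    [F.LaxLeftLinear C] [G.LaxLeftLinear C] : (F ⋙ G).LaxLeftLinear C where
  μₗ X m := μₗ G X (F.obj m) ≫ G.map (μₗ F X m)
  μₗ_naturality_left f m := by
    simp [← Functor.map_comp]
  μₗ_naturality_right X _ _ f := by
    simp [← Functor.map_comp]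
  μₗ_associativity X Y m := by
    dsimp
    simp only [Category.assoc, ← Functor.map_comp, μₗ_associativity,
      MonoidalLeftAction.actionHomRight_comp]
    simp
  μₗ_unitality m := by
    dsimp
    rw [μₗ_unitality, μₗ_unitality]; simp

/-- Composition of module functors. -/
@[simps functor]
def ModuleFunctor.comp [RigidCategory C] {P : Type*} [Category* P] [MonoidalLeftAction C P]
    (F : ModuleFunctor C M N) (G : ModuleFunctor C N P) : ModuleFunctor C M P where
  functor := F.functor ⋙ G.functor
  lax := laxComp F.functor G.functor
  isIso _ _ := @isIso_lineator _ _ _ _ _ _ _ _ _ _ _ (laxComp F.functor G.functor) _ _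

theorem laxTwist_assoc (D : C ⥤ C) [D.Monoidal] (F : M ⥤ N) [F.LaxLeftLinear C] (X Y : C) (m : M) :
    μₗ F (D.obj (X ⊗ Y)) m ≫ F.map (twistAssoc D X Y m).hom =
      (twistAssoc D X Y (F.obj m)).hom ≫ D.obj X ⊴ₗ μₗ F (D.obj Y) m ≫
        μₗ F (D.obj X) (D.obj Y ⊙ₗ m) := by
  dsimp only [twistAssoc]
  rw [Functor.map_comp, ← μₗ_naturality_left_assoc, μₗ_associativity, Category.assoc]

theorem laxTwist_unit (D : C ⥤ C) [D.Monoidal] (F : M ⥤ N) [F.LaxLeftLinear C] (m : M) :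
    (twistUnit D (F.obj m)).hom = μₗ F (D.obj (𝟙_ C)) m ≫ F.map (twistUnit D m).hom := by
  dsimp only [twistUnit]
  rw [Functor.map_comp, ← μₗ_naturality_left_assoc, ← μₗ_unitality]

/-- The twist of a lineator along a monoidal endofunctor `D` of `C`. -/
abbrev laxTwistAux (D : C ⥤ C) [D.Monoidal] (F : M ⥤ N) [F.LaxLeftLinear C] :
    @Functor.LaxLeftLinear M N _ _ F C _ _ (twistActionAux D M) (twistActionAux D N) :=
  @Functor.LaxLeftLinear.mk M N _ _ F C _ _ (twistActionAux D M) (twistActionAux D N)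
    (fun X m => μₗ F (D.obj X) m)
    (fun f m => μₗ_naturality_left F _ _)
    (fun X _ _ f => μₗ_naturality_right F _ _)
    (fun X Y m => laxTwist_assoc D F X Y m)
    (fun m => laxTwist_unit D F m)

/-- A module functor `F : M ⥤ N`, seen as a module functor between the twisted module
categories. -/
def ModuleFunctor.twist [RigidCategory C] (D : C ⥤ C) [D.Monoidal] (F : ModuleFunctor C M N) :
    ModuleFunctor C (Twist D M) (Twist D N) where
  functor := F.functor
  lax := laxTwistAux D F.functor
  isIso X m := F.isIso (D.obj X) m

/-- `k`-linear right exact module functors. -/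
structure Rex (k : Type w) [Field k] (C : Type u) [Category.{v} C] [MonoidalCategory C]
    (M : Type u') [Category.{v'} M] [MonoidalLeftAction C M] [Preadditive M] [Linear k M]
    (N : Type u'') [Category.{v''} N] [MonoidalLeftAction C N] [Preadditive N] [Linear k N]
    extends ModuleFunctor C M N where
  additive : functor.Additive
  linear : functor.Linear k
  rightExact : PreservesFiniteColimits functor

/-- `k`-linear left exact module functors. -/
structure Lex (k : Type w) [Field k] (C : Type u) [Category.{v} C] [MonoidalCategory C]
    (M : Type u') [Category.{v'} M] [MonoidalLeftAction C M] [Preadditive M] [Linear k M]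
    (N : Type u'') [Category.{v''} N] [MonoidalLeftAction C N] [Preadditive N] [Linear k N]
    extends ModuleFunctor C M N where
  additive : functor.Additive
  linear : functor.Linear k
  leftExact : PreservesFiniteLimits functor

variable (k : Type w) [Field k] [Preadditive M] [Linear k M] [Preadditive N] [Linear k N]

instance : Category (Rex k C M N) where
  Hom F G := F.Hom G.toModuleFunctor
  id F := .id _
  comp a b := a.comp b

instance : Category (Lex k C M N) where
  Hom F G := F.Hom G.toModuleFunctor
  id F := .id _
  comp a b := a.comp b

variable {k}

@[ext]
theorem Rex.hom_ext {F G : Rex k C M N} {a b : F ⟶ G} (h : ∀ m, a.nat.app m = b.nat.app m) :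
    a = b := ModuleFunctor.Hom.ext (NatTrans.ext (funext h))

@[ext]
theorem Lex.hom_ext {F G : Lex k C M N} {a b : F ⟶ G} (h : ∀ m, a.nat.app m = b.nat.app m) :
    a = b := ModuleFunctor.Hom.ext (NatTrans.ext (funext h))

@[simp] theorem Rex.comp_nat {F G H : Rex k C M N} (a : F ⟶ G) (b : G ⟶ H) :
    (a ≫ b).nat = a.nat ≫ b.nat := rfl
@[simp] theorem Rex.id_nat (F : Rex k C M N) : (𝟙 F : F ⟶ F).nat = 𝟙 _ := rfl
@[simp] theorem Lex.comp_nat {F G H : Lex k C M N} (a : F ⟶ G) (b : G ⟶ H) :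
    (a ≫ b).nat = a.nat ≫ b.nat := rfl
@[simp] theorem Lex.id_nat (F : Lex k C M N) : (𝟙 F : F ⟶ F).nat = 𝟙 _ := rfl

/-- Isomorphisms of right exact module functors from components. -/
@[simps]
def Rex.mkIso {F G : Rex k C M N} (e : ∀ m, F.functor.obj m ≅ G.functor.obj m)
    (h : ∀ {m n : M} (f : m ⟶ n), F.functor.map f ≫ (e n).hom = (e m).hom ≫ G.functor.map f)
    (c : ∀ (X : C) (m : M),
      μₗ F.functor X m ≫ (e (X ⊙ₗ m)).hom = X ⊴ₗ (e m).hom ≫ μₗ G.functor X m) :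
    F ≅ G where
  hom := { nat := (NatIso.ofComponents e h).hom, comm := c }
  inv := { nat := (NatIso.ofComponents e h).inv
           comm X m := by
            simp [← cancel_mono (e (X ⊙ₗ m)).hom, c, ← MonoidalLeftAction.actionHomRight_comp_assoc] }
  hom_inv_id := by ext m; exact (e m).hom_inv_id
  inv_hom_id := by ext m; exact (e m).inv_hom_id

/-- Isomorphisms of left exact module functors from components. -/
@[simps]
def Lex.mkIso {F G : Lex k C M N} (e : ∀ m, F.functor.obj m ≅ G.functor.obj m)
    (h : ∀ {m n : M} (f : m ⟶ n), F.functor.map f ≫ (e n).hom = (e m).hom ≫ G.functor.map f)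
    (c : ∀ (X : C) (m : M),
      μₗ F.functor X m ≫ (e (X ⊙ₗ m)).hom = X ⊴ₗ (e m).hom ≫ μₗ G.functor X m) :
    F ≅ G where
  hom := { nat := (NatIso.ofComponents e h).hom, comm := c }
  inv := { nat := (NatIso.ofComponents e h).inv
           comm X m := by
            simp [← cancel_mono (e (X ⊙ₗ m)).hom, c, ← MonoidalLeftAction.actionHomRight_comp_assoc] }
  hom_inv_id := by ext m; exact (e m).hom_inv_id
  inv_hom_id := by ext m; exact (e m).inv_hom_id

end ModuleFunctorCategories

section HomActions

open Functor.LaxLeftLinear MonoidalLeftAction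

variable {C : Type u} [Category.{v} C] [MonoidalCategory C] [RigidCategory C]

instance laxTensorRight (X : C) : (tensorRight X).LaxLeftLinear C where
  μₗ Y V := (α_ Y V X).inv

@[simp]
theorem laxTensorRight_lineator (X Y V : C) : μₗ (tensorRight X) Y V = (α_ Y V X).inv := rfl

/-- The functor `V ↦ V ⊗ X` is a left module functor from `C` to itself. -/
@[simps functor]
def tensorRightModule (X : C) : ModuleFunctor C C C where
  functor := tensorRight X
  lax := inferInstance
  isIso Y V := by dsimp; infer_instance

variable (k : Type w) [Field k] [Abelian C] [Linear k C] [MonoidalPreadditive C]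
  [MonoidalLinear k C]

theorem tensorRight_rightExact (X : C) : PreservesFiniteColimits (tensorRight X) :=
  have := (tensorRightAdjunction X (dual X)).leftAdjoint_preservesColimits
  inferInstance

theorem tensorRight_leftExact (X : C) : PreservesFiniteLimits (tensorRight X) :=
  have := (tensorRightAdjunction (ᘁX) X).rightAdjoint_preservesLimits
  inferInstance

variable {k} {M : Type u'} [Category.{v'} M] [MonoidalLeftAction C M] [Abelian M] [Linear k M]

/-- The module functor `m ↦ F m ⊗ X`. -/
@[simps! toModuleFunctor]
def Rex.act (F : Rex k C M C) (X : C) : Rex k C M C where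
  toModuleFunctor := F.comp (tensorRightModule X)
  additive := have := F.additive; inferInstanceAs (F.functor ⋙ tensorRight X).Additive
  linear := have := F.linear; inferInstanceAs ((F.functor ⋙ tensorRight X).Linear k)
  rightExact :=
    have := F.rightExact
    have := tensorRight_rightExact X
    inferInstanceAs (PreservesFiniteColimits (F.functor ⋙ tensorRight X))

/-- The module functor `V ↦ G (V ⊗ X)`. -/
@[simps! toModuleFunctor]
def Lex.act (X : C) (G : Lex k C C M) : Lex k C C M where
  toModuleFunctor := (tensorRightModule X).comp G.toModuleFunctor
  additive := have := G.additive; inferInstanceAs (tensorRight X ⋙ G.functor).Additive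
  linear := have := G.linear; inferInstanceAs ((tensorRight X ⋙ G.functor).Linear k)
  leftExact :=
    have := G.leftExact
    have := tensorRight_leftExact X
    inferInstanceAs (PreservesFiniteLimits (tensorRight X ⋙ G.functor))

theorem Rex.act_obj (F : Rex k C M C) (X : C) (m : M) :
    (F.act X).functor.obj m = F.functor.obj m ⊗ X := rfl

theorem Rex.act_map (F : Rex k C M C) (X : C) {m n : M} (f : m ⟶ n) :
    (F.act X).functor.map f = F.functor.map f ▷ X := rfl

theorem Rex.act_lineator (F : Rex k C M C) (X Y : C) (m : M) :
    μₗ (F.act X).functor Y m = (α_ _ _ _).inv ≫ μₗ F.functor Y m ▷ X := rfl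

theorem Lex.act_obj (X : C) (G : Lex k C C M) (V : C) :
    (G.act X).functor.obj V = G.functor.obj (V ⊗ X) := rfl

theorem Lex.act_map (X : C) (G : Lex k C C M) {V W : C} (f : V ⟶ W) :
    (G.act X).functor.map f = G.functor.map (f ▷ X) := rfl

theorem Lex.act_lineator (X : C) (G : Lex k C C M) (Y V : C) :
    μₗ (G.act X).functor Y V = μₗ G.functor Y (V ⊗ X) ≫ G.functor.map (α_ Y V X).inv := rfl

/-- The right action of `C` on right exact module functors, `(F ◁ X) m = F m ⊗ X`. -/
instance rexAction : MonoidalRightAction C (Rex k C M C) where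
  actionObj F X := F.act X
  actionHomLeft {F G} a X :=
    { nat := { app m := a.nat.app m ▷ X
               naturality m n f := by simp [Rex.act_map, Rex.act_obj, ← comp_whiskerRight] }
      comm Y m := by
        have := a.comm Y m
        simp only [selfLeftAction_actionHomRight] at this
        simp [Rex.act_lineator, Rex.act_obj]
        rw [← comp_whiskerRight, this]; simp }
  actionHomRight F X Y f :=
    { nat := { app m := F.functor.obj m ◁ f
               naturality m n g := by simp [Rex.act_map, Rex.act_obj, whisker_exchange] }
      comm Z m := by
        simp [Rex.act_lineator, Rex.act_obj]
        rw [← whisker_exchange]; simp }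
  actionAssocIso F X Y := Rex.mkIso (fun m => (α_ (F.functor.obj m) X Y).symm)
    (fun f => by simp [Rex.act_map, Rex.act_obj])
    (fun Z m => by simp [Rex.act_lineator, Rex.act_obj])
  actionUnitIso F := Rex.mkIso (fun m => ρ_ (F.functor.obj m))
    (fun f => by simp [Rex.act_map, Rex.act_obj])
    (fun Z m => by simp [Rex.act_lineator, Rex.act_obj])
  actionHom_def _ _ := rfl
  actionHomRight_id X F := Rex.hom_ext fun m => MonoidalCategory.whiskerLeft_id _ _
  id_actionHomLeft X F := Rex.hom_ext fun m => MonoidalCategory.id_whiskerRight _ _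
  actionHom_comp {_ _ _ _ _ _} f₁ f₂ g₁ g₂ := Rex.hom_ext fun m => by
    have h {A A' A'' X X' X'' : C} (f₁ : A ⟶ A') (f₂ : A' ⟶ A'') (g₁ : X ⟶ X') (g₂ : X' ⟶ X'') :
      (f₁ ≫ f₂) ▷ X ≫ A'' ◁ (g₁ ≫ g₂) = (f₁ ▷ X ≫ A' ◁ g₁) ≫ f₂ ▷ X' ≫ A'' ◁ g₂ := by
      simp [whisker_exchange_assoc]
    exact h (f₁.nat.app m) (f₂.nat.app m) g₁ g₂
  actionAssocIso_hom_naturality f g h := Rex.hom_ext fun m => by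
    have h {A A' X X' Y Y' : C} (f : A ⟶ A') (g : X ⟶ X') (h : Y ⟶ Y') :
      (f ▷ (X ⊗ Y) ≫ A' ◁ (g ⊗ₘ h)) ≫ (α_ A' X' Y').inv =
        (α_ A X Y).inv ≫ ((f ▷ X ≫ A' ◁ g) ▷ Y ≫ (A' ⊗ X') ◁ h) := by
      rw [MonoidalCategory.tensorHom_def]; simp
    exact h (f.nat.app m) g _
  actionUnitIso_hom_naturality f := Rex.hom_ext fun m =>
    (rightUnitor_naturality (f.nat.app m)).symm
  actionHomRight_whiskerRight f c d := Rex.hom_ext fun m => by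
    have h {X Y : C} (f : X ⟶ Y) (c d : C) : d ◁ (f ▷ c) = (α_ d X c).inv ≫ (d ◁ f) ▷ c ≫
      (α_ d Y c).hom := by simp
    exact h f c _
  whiskerRight_actionHomLeft c _ _ f d := Rex.hom_ext fun m => by
    have h {X Y : C} (f : X ⟶ Y) (c d : C) : d ◁ (c ◁ f) = (α_ d c X).inv ≫ (d ⊗ c) ◁ f ≫
      (α_ d c Y).hom := by simp
    exact h f c _
  actionHom_associator c₁ c₂ c₃ d := Rex.hom_ext fun m => by
    have h (d : C) : d ◁ (α_ c₁ c₂ c₃).hom ≫ (α_ d c₁ (c₂ ⊗ c₃)).inv ≫ (α_ (d ⊗ c₁) c₂ c₃).inv =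
      (α_ d (c₁ ⊗ c₂) c₃).inv ≫ (α_ d c₁ c₂).inv ▷ c₃ := by monoidal
    exact h _
  actionHom_leftUnitor c d := Rex.hom_ext fun m => by
    have h (d : C) : d ◁ (λ_ c).hom = (α_ d (𝟙_ C) c).inv ≫ (ρ_ d).hom ▷ c := by monoidal
    exact h _
  actionHom_rightUnitor c d := Rex.hom_ext fun m => by
    have h (d : C) : d ◁ (ρ_ c).hom = (α_ d c (𝟙_ C)).inv ≫ (ρ_ (d ⊗ c)).hom := by monoidal
    exact h _

theorem lineator_natR (G : C ⥤ M) [G.LaxLeftLinear C] (X : C) {V W : C} (f : V ⟶ W) :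
    X ⊴ₗ G.map f ≫ μₗ G X W = μₗ G X V ≫ G.map (X ◁ f) := μₗ_naturality_right G X f

/-- The left action of `C` on left exact module functors, `(X ▷ G) V = G (V ⊗ X)`. -/
instance lexAction : MonoidalLeftAction C (Lex k C C M) where
  actionObj X G := G.act X
  actionHomRight X G H a :=
    { nat := { app V := a.nat.app (V ⊗ X)
               naturality V W f := a.nat.naturality _ }
      comm Y V := by
        have h := (reassoc_of% a.comm Y (V ⊗ X)) (H.functor.map (α_ Y V X).inv)
        have h' : (μₗ G.functor Y (V ⊗ X) ≫ G.functor.map (α_ Y V X).inv) ≫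
            a.nat.app ((Y ⊗ V) ⊗ X) = μₗ G.functor Y (V ⊗ X) ≫ a.nat.app (Y ⊗ (V ⊗ X)) ≫
              H.functor.map (α_ Y V X).inv := by simp
        exact h'.trans h }
  actionHomLeft {X Y} f G :=
    { nat := { app V := G.functor.map (V ◁ f)
               naturality V W g := by
                have h : G.functor.map (g ▷ X) ≫ G.functor.map (W ◁ f) =
                    G.functor.map (V ◁ f) ≫ G.functor.map (g ▷ Y) := by
                  rw [← Functor.map_comp, ← Functor.map_comp, whisker_exchange]
                exact h }
      comm Z V := by
        have h : (μₗ G.functor Z (V ⊗ X) ≫ G.functor.map (α_ Z V X).inv) ≫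
            G.functor.map ((Z ⊗ V) ◁ f) = Z ⊴ₗ G.functor.map (V ◁ f) ≫
              μₗ G.functor Z (V ⊗ Y) ≫ G.functor.map (α_ Z V Y).inv := by
          rw [reassoc_of% lineator_natR]
          simp [← Functor.map_comp]
        exact h }
  actionAssocIso X Y G := Lex.mkIso (fun V => G.functor.mapIso (α_ V X Y).symm)
    (fun {V W} f => by
      have h : G.functor.map (f ▷ (X ⊗ Y)) ≫ G.functor.map (α_ W X Y).inv =
          G.functor.map (α_ V X Y).inv ≫ G.functor.map (f ▷ X ▷ Y) := by
        simp [← Functor.map_comp]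
      exact h)
    (fun Z V => by
      have h : (μₗ G.functor Z (V ⊗ X ⊗ Y) ≫ G.functor.map (α_ Z V (X ⊗ Y)).inv) ≫
          G.functor.map (α_ (Z ⊗ V) X Y).inv = Z ⊴ₗ G.functor.map (α_ V X Y).inv ≫
            (μₗ G.functor Z ((V ⊗ X) ⊗ Y) ≫ G.functor.map (α_ Z (V ⊗ X) Y).inv) ≫
              G.functor.map ((α_ Z V X).inv ▷ Y) := by
        rw [Category.assoc, Category.assoc, reassoc_of% lineator_natR]
        simp [← Functor.map_comp]
      exact h)
  actionUnitIso G := Lex.mkIso (fun V => G.functor.mapIso (ρ_ V))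
    (fun {V W} f => by
      have h : G.functor.map (f ▷ 𝟙_ C) ≫ G.functor.map (ρ_ W).hom =
          G.functor.map (ρ_ V).hom ≫ G.functor.map f := by
        simp [← Functor.map_comp]
      exact h)
    (fun Z V => by
      have h : (μₗ G.functor Z (V ⊗ 𝟙_ C) ≫ G.functor.map (α_ Z V (𝟙_ C)).inv) ≫
          G.functor.map (ρ_ (Z ⊗ V)).hom = Z ⊴ₗ G.functor.map (ρ_ V).hom ≫ μₗ G.functor Z V := by
        rw [lineator_natR]
        simp [← Functor.map_comp]
      exact h)
  actionHom_def _ _ := rfl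
  actionHomRight_id X G := Lex.hom_ext fun m => rfl
  id_actionHomLeft X G := Lex.hom_ext fun m => by
    have h (V : C) : G.functor.map (V ◁ 𝟙 X) = 𝟙 (G.functor.obj (V ⊗ X)) := by simp
    exact h m
  actionHom_comp {_ _ _ G₁ G₂ G₃} f₁ f₂ g₁ g₂ := Lex.hom_ext fun m => by
    have h {X X' X'' : C} (f₁ : X ⟶ X') (f₂ : X' ⟶ X'') : G₁.functor.map (m ◁ (f₁ ≫ f₂)) ≫
        (g₁ ≫ g₂).nat.app (m ⊗ X'') = (G₁.functor.map (m ◁ f₁) ≫ g₁.nat.app _) ≫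
          G₂.functor.map (m ◁ f₂) ≫ g₂.nat.app _ := by simp
    exact h f₁ f₂
  actionAssocIso_hom_naturality {_ _ _ _ G₁ G₂} f g h := Lex.hom_ext fun m => by
    have e {X X' Y Y' : C} (f : X ⟶ X') (g : Y ⟶ Y') :
      (G₁.functor.map (m ◁ (f ⊗ₘ g)) ≫ h.nat.app (m ⊗ (X' ⊗ Y'))) ≫
          G₂.functor.map (α_ m X' Y').inv =
        G₁.functor.map (α_ m X Y).inv ≫ G₁.functor.map ((m ◁ f) ▷ Y) ≫
          G₁.functor.map ((m ⊗ X') ◁ g) ≫ h.nat.app ((m ⊗ X') ⊗ Y') := by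
      rw [Category.assoc, ← h.nat.naturality]
      simp only [← Functor.map_comp_assoc]
      congr 2
      rw [MonoidalCategory.tensorHom_def]; simp
    exact e f g
  actionUnitIso_hom_naturality f := Lex.hom_ext fun m => f.nat.naturality (ρ_ m).hom
  whiskerLeft_actionHomLeft c X Y f G := Lex.hom_ext fun m => by
    have h : G.functor.map (m ◁ (c ◁ f)) = G.functor.map (α_ m c X).inv ≫
        G.functor.map ((m ⊗ c) ◁ f) ≫ G.functor.map (α_ m c Y).hom := by
      simp [← Functor.map_comp]
    exact h
  whiskerRight_actionHomLeft {X Y} c f G := Lex.hom_ext fun m => by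
    have h : G.functor.map (m ◁ (f ▷ c)) = G.functor.map (α_ m X c).inv ≫
        G.functor.map ((m ◁ f) ▷ c) ≫ G.functor.map (α_ m Y c).hom := by
      simp [← Functor.map_comp]
    exact h
  associator_actionHom c₁ c₂ c₃ G := Lex.hom_ext fun m => by
    have h : G.functor.map (m ◁ (α_ c₁ c₂ c₃).hom) ≫ G.functor.map (α_ m c₁ (c₂ ⊗ c₃)).inv ≫
        G.functor.map (α_ (m ⊗ c₁) c₂ c₃).inv =
      G.functor.map (α_ m (c₁ ⊗ c₂) c₃).inv ≫ G.functor.map ((α_ m c₁ c₂).inv ▷ c₃) := by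
      simp [← Functor.map_comp]
    exact h
  leftUnitor_actionHom c G := Lex.hom_ext fun m => by
    have h : G.functor.map (m ◁ (λ_ c).hom) = G.functor.map (α_ m (𝟙_ C) c).inv ≫
        G.functor.map ((ρ_ m).hom ▷ c) := by
      simp [← Functor.map_comp]
    exact h
  rightUnitor_actionHom c G := Lex.hom_ext fun m => by
    have h : G.functor.map (m ◁ (ρ_ c).hom) = G.functor.map (α_ m c (𝟙_ C)).inv ≫
        G.functor.map (ρ_ (m ⊗ c)).hom := by
      simp [← Functor.map_comp]
    exact h

end HomActions

section InternalHoms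

open Functor.LaxLeftLinear MonoidalLeftAction

variable {C : Type u} [Category.{v} C] [MonoidalCategory C]
  {M : Type u'} [Category.{v'} M] [MonoidalLeftAction C M]

variable (C M) in
/-- A choice of internal Hom functors: `Y m = [m, -]` is right adjoint to `X ↦ X ⊙ₗ m`. -/
structure InternalHom where
  Y (m : M) : M ⥤ C
  adj (m : M) : actionRight C m ⊣ Y m

namespace InternalHom

variable (H : InternalHom C M)

/-- The internal Hom object `[m, n]`. -/
abbrev hom (m n : M) : C := (H.Y m).obj n

/-- The internal evaluation. -/
def ieval (m n : M) : H.hom m n ⊙ₗ m ⟶ n := (H.adj m).counit.app n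

/-- The adjunction bijection. -/
def curry {X : C} {m n : M} (f : X ⊙ₗ m ⟶ n) : X ⟶ H.hom m n := (H.adj m).homEquiv X n f

@[simp]
theorem curry_ieval {X : C} {m n : M} (f : X ⊙ₗ m ⟶ n) :
    H.curry f ⊵ₗ m ≫ H.ieval m n = f :=
  ((H.adj m).homEquiv_counit X n _).symm.trans (((H.adj m).homEquiv X n).symm_apply_apply f)

@[simp]
theorem curry_ieval_assoc {X : C} {m n p : M} (f : X ⊙ₗ m ⟶ n) (h : n ⟶ p) :
    H.curry f ⊵ₗ m ≫ H.ieval m n ≫ h = f ≫ h := by rw [reassoc_of% H.curry_ieval f]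

variable {H} in
theorem hom_ext {X : C} {m n : M} {f g : X ⟶ H.hom m n}
    (h : f ⊵ₗ m ≫ H.ieval m n = g ⊵ₗ m ≫ H.ieval m n) : f = g :=
  ((H.adj m).homEquiv X n).symm.injective
    (((H.adj m).homEquiv_counit X n f).trans (h.trans ((H.adj m).homEquiv_counit X n g).symm))

@[simp]
theorem map_ieval (m : M) {n n' : M} (f : n ⟶ n') :
    (H.Y m).map f ⊵ₗ m ≫ H.ieval m n' = H.ieval m n ≫ f :=
  (H.adj m).counit.naturality f

@[simp]
theorem map_ieval_assoc (m : M) {n n' p : M} (f : n ⟶ n') (h : n' ⟶ p) :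
    (H.Y m).map f ⊵ₗ m ≫ H.ieval m n' ≫ h = H.ieval m n ≫ f ≫ h := by
  rw [reassoc_of% H.map_ieval m f]

/-- The canonical lineator `X ⊗ [m, n] ⟶ [m, X ⊙ₗ n]`. -/
def a (X : C) (m n : M) : X ⊗ H.hom m n ⟶ H.hom m (X ⊙ₗ n) :=
  H.curry ((αₗ _ _ _).hom ≫ X ⊴ₗ H.ieval m n)

@[simp]
theorem a_ieval (X : C) (m n : M) :
    H.a X m n ⊵ₗ m ≫ H.ieval m (X ⊙ₗ n) = (αₗ _ _ _).hom ≫ X ⊴ₗ H.ieval m n :=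
  H.curry_ieval _

@[simp]
theorem a_ieval_assoc (X : C) (m n : M) {p : M} (h : X ⊙ₗ n ⟶ p) :
    H.a X m n ⊵ₗ m ≫ H.ieval m (X ⊙ₗ n) ≫ h = (αₗ _ _ _).hom ≫ X ⊴ₗ H.ieval m n ≫ h := by
  rw [reassoc_of% H.a_ieval X m n]

instance laxY (m : M) : (H.Y m).LaxLeftLinear C where
  μₗ X n := H.a X m n
  μₗ_naturality_left f n := hom_ext (by simp [MonoidalLeftAction.action_exchange])
  μₗ_naturality_right X _ _ f := hom_ext (by
    simp [← MonoidalLeftAction.actionHomRight_comp])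
  μₗ_associativity X X' n := hom_ext (by
    simp [← MonoidalLeftAction.actionHomRight_comp, -MonoidalLeftAction.tensor_actionHomRight]
    simp)
  μₗ_unitality n := hom_ext (by
    simp [← MonoidalLeftAction.actionUnitIso_hom_naturality])

/-- Functoriality of the internal Hom in the first variable. -/
def pre {m m' : M} (f : m ⟶ m') (n : M) : H.hom m' n ⟶ H.hom m n :=
  H.curry (_ ⊴ₗ f ≫ H.ieval m' n)

@[simp]
theorem pre_ieval {m m' : M} (f : m ⟶ m') (n : M) :
    H.pre f n ⊵ₗ m ≫ H.ieval m n = _ ⊴ₗ f ≫ H.ieval m' n :=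
  H.curry_ieval _

@[simp]
theorem pre_ieval_assoc {m m' : M} (f : m ⟶ m') (n : M) {p : M} (h : n ⟶ p) :
    H.pre f n ⊵ₗ m ≫ H.ieval m n ≫ h = _ ⊴ₗ f ≫ H.ieval m' n ≫ h := by
  rw [reassoc_of% H.pre_ieval f n]

theorem pre_id (m n : M) : H.pre (𝟙 m) n = 𝟙 _ := hom_ext (by simp)

theorem pre_comp {m m' m'' : M} (f : m ⟶ m') (g : m' ⟶ m'') (n : M) :
    H.pre (f ≫ g) n = H.pre g n ≫ H.pre f n :=
  hom_ext (by simp [← MonoidalLeftAction.action_exchange_assoc])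

theorem pre_natural {m m' : M} (f : m ⟶ m') {n n' : M} (g : n ⟶ n') :
    (H.Y m').map g ≫ H.pre f n' = H.pre f n ≫ (H.Y m).map g :=
  hom_ext (by simp [← MonoidalLeftAction.action_exchange_assoc])

theorem a_pre {m m' : M} (f : m ⟶ m') (X : C) (n : M) :
    H.a X m' n ≫ H.pre f (X ⊙ₗ n) = X ◁ H.pre f n ≫ H.a X m n :=
  hom_ext (by
    simp [← MonoidalLeftAction.action_exchange_assoc, ← MonoidalLeftAction.actionHomRight_comp])

section Contraction

variable (X X' : C) [ExactPairing X X']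

/-- Contraction of `X'` with `X`. -/
def contr (A : C) : (A ⊗ X') ⊗ X ⟶ A := (α_ _ _ _).hom ≫ A ◁ ε_ X X' ≫ (ρ_ A).hom

/-- Insertion of `X ⊗ X'`. -/
def insert (A : C) : A ⟶ (A ⊗ X) ⊗ X' := (ρ_ A).inv ≫ A ◁ η_ X X' ≫ (α_ _ _ _).inv

/-- Contraction of `X'` with `X`, acting on `m`. -/
def contrAct (A : C) (m : M) : (A ⊗ X') ⊙ₗ (X ⊙ₗ m) ⟶ A ⊙ₗ m :=
  (αₗ _ _ _).inv ≫ contr X X' A ⊵ₗ m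

theorem contr_natural {A B : C} (f : A ⟶ B) :
    (f ▷ X' ▷ X) ≫ contr X X' B = contr X X' A ≫ f := by
  simp only [contr, Category.assoc]
  rw [associator_naturality_left_assoc, ← whisker_exchange_assoc, rightUnitor_naturality]

theorem insert_contr (A : C) : insert X X' A ▷ X ≫ contr X X' (A ⊗ X) = 𝟙 _ := by
  calc _ = 𝟙 _ ⊗≫ A ◁ (η_ X X' ▷ X ⊗≫ X ◁ ε_ X X') ⊗≫ 𝟙 _ := by
        rw [insert, contr]; monoidal
    _ = _ := by rw [ExactPairing.evaluation_coevaluation'']; monoidal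

theorem insert_contr' (A : C) : insert X X' (A ⊗ X') ≫ contr X X' A ▷ X' = 𝟙 _ := by
  calc _ = 𝟙 _ ⊗≫ A ◁ (X' ◁ η_ X X' ⊗≫ ε_ X X' ▷ X') ⊗≫ 𝟙 _ := by
        rw [insert, contr]; monoidal
    _ = _ := by rw [ExactPairing.coevaluation_evaluation'']; monoidal

theorem insert_natural {A B : C} (f : A ⟶ B) :
    insert X X' A ≫ f ▷ X ▷ X' = f ≫ insert X X' B := by
  simp only [insert, Category.assoc]
  rw [← associator_inv_naturality_left, whisker_exchange_assoc, ← rightUnitor_inv_naturality_assoc]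

theorem contrAct_natural {A B : C} (f : A ⟶ B) (m : M) :
    (f ▷ X') ⊵ₗ (X ⊙ₗ m) ≫ contrAct X X' B m = contrAct X X' A m ≫ f ⊵ₗ m := by
  simp only [contrAct, Category.assoc]
  rw [← MonoidalLeftAction.comp_actionHomLeft, ← contr_natural,
    MonoidalLeftAction.comp_actionHomLeft, MonoidalLeftAction.whiskerRight_actionHomLeft X]
  simp only [Category.assoc, Iso.inv_hom_id_assoc]

theorem contrAct_natural_right (A : C) {m n : M} (f : m ⟶ n) :
    (A ⊗ X') ⊴ₗ X ⊴ₗ f ≫ contrAct X X' A n = contrAct X X' A m ≫ A ⊴ₗ f := by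
  simp only [contrAct, Category.assoc]
  rw [← MonoidalLeftAction.action_exchange]
  simp

/-- The canonical isomorphism `[m, n] ⊗ X' ≅ [X ⊙ₗ m, n]`. -/
def b (m n : M) : H.hom m n ⊗ X' ≅ H.hom (X ⊙ₗ m) n where
  hom := H.curry (contrAct X X' _ m ≫ H.ieval m n)
  inv := insert X X' _ ≫ H.curry ((αₗ _ _ _).hom ≫ H.ieval (X ⊙ₗ m) n) ▷ X'
  hom_inv_id := by
    rw [← reassoc_of% insert_natural, ← comp_whiskerRight]
    have : H.curry (contrAct X X' _ m ≫ H.ieval m n) ▷ X ≫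
        H.curry ((αₗ _ _ _).hom ≫ H.ieval (X ⊙ₗ m) n) = contr X X' (H.hom m n) :=
      hom_ext (by
        rw [MonoidalLeftAction.comp_actionHomLeft, Category.assoc, curry_ieval, ← reassoc_of% assoc_natL,
          curry_ieval, contrAct]
        simp)
    rw [this, insert_contr']
  inv_hom_id := hom_ext (by
    rw [MonoidalLeftAction.comp_actionHomLeft, MonoidalLeftAction.comp_actionHomLeft,
      Category.assoc, Category.assoc, curry_ieval, reassoc_of% contrAct_natural, curry_ieval, contrAct,
      Category.assoc, ← cancel_epi (αₗ _ _ _).hom, reassoc_of% assoc_natL]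
    simp only [Iso.hom_inv_id_assoc]
    rw [← MonoidalLeftAction.comp_actionHomLeft_assoc, insert_contr]
    simp)

@[simp]
theorem b_ieval (m n : M) : (H.b X X' m n).hom ⊵ₗ (X ⊙ₗ m) ≫ H.ieval (X ⊙ₗ m) n =
    contrAct X X' _ m ≫ H.ieval m n := H.curry_ieval _

@[simp]
theorem b_ieval_assoc (m n : M) {p : M} (h : n ⟶ p) :
    (H.b X X' m n).hom ⊵ₗ (X ⊙ₗ m) ≫ H.ieval (X ⊙ₗ m) n ≫ h =
      contrAct X X' _ m ≫ H.ieval m n ≫ h := by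
  rw [reassoc_of% H.b_ieval X X' m n]

end Contraction

end InternalHom

end InternalHoms

section YonedaFunctor

open Functor.LaxLeftLinear MonoidalLeftAction Opposite

namespace InternalHom

variable {C : Type u} [Category.{v} C] [MonoidalCategory C]
  {M : Type u'} [Category.{v'} M] [MonoidalLeftAction C M] (H : InternalHom C M)

theorem pentagon_hom_inv (X Y Z : C) (m : M) :
    (αₗ X Y (Z ⊙ₗ m)).hom ≫ X ⊴ₗ (αₗ Y Z m).inv =
      (αₗ _ _ _).inv ≫ (α_ X Y Z).hom ⊵ₗ m ≫ (αₗ X (Y ⊗ Z) m).hom := by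
  rw [Iso.eq_inv_comp, ← associator_actionHom_assoc]
  simp

theorem pentagon_hom_inv_inv (X Y Z : C) (m : M) :
    X ⊴ₗ (αₗ Y Z m).hom ≫ (αₗ X Y (Z ⊙ₗ m)).inv ≫ (αₗ (X ⊗ Y) Z m).inv =
      (αₗ X (Y ⊗ Z) m).inv ≫ (α_ X Y Z).inv ⊵ₗ m := by
  rw [Iso.eq_inv_comp, ← cancel_epi ((α_ X Y Z).hom ⊵ₗ m), reassoc_of% associator_actionHom X Y Z m]
  simp

theorem contr_tensor_left (X X' : C) [ExactPairing X X'] (Z A : C) :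
    (α_ Z A X').inv ▷ X ≫ contr X X' (Z ⊗ A) = (α_ _ _ _).hom ≫ Z ◁ contr X X' A := by
  rw [contr, contr]; monoidal

theorem contrAct_tensor_left (X X' : C) [ExactPairing X X'] (Z A : C) (m : M) :
    (α_ Z A X').inv ⊵ₗ (X ⊙ₗ m) ≫ contrAct X X' (Z ⊗ A) m ≫ (αₗ Z A m).hom =
      (αₗ Z (A ⊗ X') (X ⊙ₗ m)).hom ≫ Z ⊴ₗ contrAct X X' A m := by
  have h := congrArg (fun t => t ⊵ₗ m) (contr_tensor_left X X' Z A)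
  simp only [MonoidalLeftAction.comp_actionHomLeft,
    MonoidalLeftAction.whiskerLeft_actionHomLeft] at h
  simp only [contrAct, Category.assoc, MonoidalLeftAction.actionHomRight_comp]
  rw [MonoidalLeftAction.actionHomLeft_action_assoc]
  simp only [Iso.hom_inv_id_assoc]
  rw [reassoc_of% h, reassoc_of% pentagon_hom_inv]
  simp

theorem a_b (X X' : C) [ExactPairing X X'] (Z : C) (m n : M) :
    (α_ Z (H.hom m n) X').inv ≫ H.a Z m n ▷ X' ≫ (H.b X X' m (Z ⊙ₗ n)).hom =
      Z ◁ (H.b X X' m n).hom ≫ H.a Z (X ⊙ₗ m) n := by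
  apply hom_ext
  simp only [MonoidalLeftAction.comp_actionHomLeft, Category.assoc, b_ieval, a_ieval]
  rw [reassoc_of% contrAct_natural, a_ieval, reassoc_of% contrAct_tensor_left, ← reassoc_of% assoc_natM,
    ← MonoidalLeftAction.actionHomRight_comp, ← MonoidalLeftAction.actionHomRight_comp, b_ieval]

theorem b_natural (X X' : C) [ExactPairing X X'] (m : M) {n n' : M} (g : n ⟶ n') :
    (H.Y m).map g ▷ X' ≫ (H.b X X' m n').hom = (H.b X X' m n).hom ≫ (H.Y (X ⊙ₗ m)).map g := by
  apply hom_ext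
  rw [MonoidalLeftAction.comp_actionHomLeft, MonoidalLeftAction.comp_actionHomLeft, Category.assoc,
    Category.assoc, map_ieval, b_ieval, b_ieval_assoc, reassoc_of% contrAct_natural, map_ieval]

theorem b_pre (X X' : C) [ExactPairing X X'] {m m' : M} (g : m ⟶ m') (n : M) :
    H.pre g n ▷ X' ≫ (H.b X X' m n).hom = (H.b X X' m' n).hom ≫ H.pre (X ⊴ₗ g) n := by
  apply hom_ext
  rw [MonoidalLeftAction.comp_actionHomLeft, MonoidalLeftAction.comp_actionHomLeft, Category.assoc,
    Category.assoc, pre_ieval, b_ieval, ← MonoidalLeftAction.action_exchange_assoc, b_ieval,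
    reassoc_of% contrAct_natural, reassoc_of% contrAct_natural_right, pre_ieval]

variable [RigidCategory C]

theorem contr_dual {X Z : C} (f : X ⟶ Z) (A : C) :
    (A ◁ dualMap f) ▷ X ≫ contr X (dual X) A = (A ⊗ dual Z) ◁ f ≫ contr Z (dual Z) A := by
  have h := dualMap_ev f
  rw [ev, ev] at h
  calc _ = 𝟙 _ ⊗≫ A ◁ (dualMap f ▷ X ≫ ε_ X (dual X)) ⊗≫ 𝟙 _ := by
        rw [contr]; monoidal
    _ = _ := by rw [h, contr]; monoidal

theorem contrAct_dual {X Z : C} (f : X ⟶ Z) (A : C) (m : M) :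
    (A ◁ dualMap f) ⊵ₗ (X ⊙ₗ m) ≫ contrAct X (dual X) A m =
      (A ⊗ dual Z) ⊴ₗ (f ⊵ₗ m) ≫ contrAct Z (dual Z) A m := by
  have h := congrArg (fun t => t ⊵ₗ m) (contr_dual f A)
  simp only [MonoidalLeftAction.comp_actionHomLeft] at h
  rw [contrAct, contrAct, MonoidalLeftAction.actionHomLeft_action_assoc,
    ← cancel_epi (αₗ _ _ _).hom, reassoc_of% assoc_natM]
  simp only [Iso.hom_inv_id_assoc, h]

theorem b_dual {X Z : C} (f : X ⟶ Z) (m n : M) :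
    H.hom m n ◁ dualMap f ≫ (H.b X (dual X) m n).hom =
      (H.b Z (dual Z) m n).hom ≫ H.pre (f ⊵ₗ m) n := by
  apply hom_ext
  rw [MonoidalLeftAction.comp_actionHomLeft, MonoidalLeftAction.comp_actionHomLeft, Category.assoc,
    Category.assoc, pre_ieval, b_ieval, ← MonoidalLeftAction.action_exchange_assoc, b_ieval,
    reassoc_of% contrAct_dual f]

theorem contr_tensor (X Z A : C) :
    ((α_ _ _ _).hom ≫ A ◁ (dualTensor X Z).inv) ▷ (X ⊗ Z) ≫ contr (X ⊗ Z) (dual (X ⊗ Z)) A =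
      (α_ _ _ _).inv ≫ contr X (dual X) (A ⊗ dual Z) ▷ Z ≫ contr Z (dual Z) A := by
  have h := dualTensor_inv_ev X Z
  rw [ev, evTensor, ev, ev] at h
  calc _ = 𝟙 _ ⊗≫ A ◁ ((dualTensor X Z).inv ▷ (X ⊗ Z) ≫ ε_ (X ⊗ Z) (dual (X ⊗ Z))) ⊗≫ 𝟙 _ := by
        rw [contr]; monoidal
    _ = _ := by rw [h, contr, contr]; monoidal

theorem contrAct_tensor (X Z A : C) (m : M) :
    ((α_ _ _ _).hom ≫ A ◁ (dualTensor X Z).inv) ⊵ₗ ((X ⊗ Z) ⊙ₗ m) ≫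
        contrAct (X ⊗ Z) (dual (X ⊗ Z)) A m =
      _ ⊴ₗ (αₗ X Z m).hom ≫ contrAct X (dual X) (A ⊗ dual Z) (Z ⊙ₗ m) ≫
        contrAct Z (dual Z) A m := by
  have h := congrArg (fun t => t ⊵ₗ m) (contr_tensor X Z A)
  simp only [MonoidalLeftAction.comp_actionHomLeft] at h
  rw [contrAct, contrAct, contrAct, MonoidalLeftAction.actionHomLeft_action]
  simp only [Category.assoc, Iso.hom_inv_id_assoc, h]
  rw [MonoidalLeftAction.actionHomLeft_action (contr X (dual X) (A ⊗ dual Z)) Z m]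
  simp only [Category.assoc, Iso.hom_inv_id_assoc]
  rw [reassoc_of% pentagon_hom_inv_inv]

theorem b_tensor (X Z : C) (m n : M) :
    (α_ _ _ _).hom ≫ H.hom m n ◁ (dualTensor X Z).inv ≫
        (H.b (X ⊗ Z) (dual (X ⊗ Z)) m n).hom =
      (H.b Z (dual Z) m n).hom ▷ dual X ≫ (H.b X (dual X) (Z ⊙ₗ m) n).hom ≫
        H.pre (αₗ X Z m).hom n := by
  apply hom_ext
  have h := contrAct_tensor X Z (H.hom m n) m
  simp only [MonoidalLeftAction.comp_actionHomLeft, Category.assoc, b_ieval, pre_ieval] at h ⊢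
  rw [reassoc_of% h, ← MonoidalLeftAction.action_exchange_assoc,
    ← MonoidalLeftAction.action_exchange_assoc, b_ieval, reassoc_of% contrAct_natural, b_ieval]

theorem contr_unit (A : C) :
    ((ρ_ A).inv ≫ A ◁ (dualUnit (C := C)).inv) ▷ 𝟙_ C ≫ contr (𝟙_ C) (dual (𝟙_ C)) A =
      (ρ_ A).hom := by
  have h := dualUnit_inv_ev (C := C)
  rw [ev] at h
  calc _ = 𝟙 _ ⊗≫ A ◁ ((dualUnit (C := C)).inv ▷ 𝟙_ C ≫ ε_ (𝟙_ C) (dual (𝟙_ C))) ⊗≫ 𝟙 _ := by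
        rw [contr]; monoidal
    _ = _ := by rw [h]; monoidal

theorem b_unit (m n : M) :
    ((ρ_ _).inv ≫ H.hom m n ◁ (dualUnit (C := C)).inv) ≫
      (H.b (𝟙_ C) (dual (𝟙_ C)) m n).hom = H.pre (λₗ[C] m).hom n := by
  apply hom_ext
  rw [MonoidalLeftAction.comp_actionHomLeft, Category.assoc, b_ieval, contrAct,
    MonoidalLeftAction.actionHomLeft_action, pre_ieval]
  simp only [Category.assoc, Iso.hom_inv_id_assoc]
  rw [← MonoidalLeftAction.comp_actionHomLeft_assoc, contr_unit]
  simp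

end InternalHom

end YonedaFunctor

section YonedaModuleFunctor

open Functor.LaxLeftLinear MonoidalLeftAction Opposite

namespace InternalHom

theorem Y_additive (k : Type w) [Field k] {C : Type u} [Category.{v} C] [Abelian C] [Linear k C]
    [MonoidalCategory C] [MonoidalPreadditive C] [MonoidalLinear k C] [RigidCategory C]
    [FiniteTensorCategory k C]
    {M : Type u'} [Category.{v'} M] [Abelian M] [Linear k M] [MonoidalLeftAction C M]
    [ExactModuleCategory k C M] (H : InternalHom C M) (m : M) : (H.Y m).Additive :=
  have := ExactModuleCategory.actionRight_additive k (C := C) m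
  (H.adj m).right_adjoint_additive

theorem Y_preservesEpimorphisms (k : Type w) [Field k] {C : Type u} [Category.{v} C] [Abelian C] [Linear k C]
    [MonoidalCategory C] [MonoidalPreadditive C] [MonoidalLinear k C] [RigidCategory C]
    [FiniteTensorCategory k C]
    {M : Type u'} [Category.{v'} M] [Abelian M] [Linear k M] [MonoidalLeftAction C M]
    [ExactModuleCategory k C M] (H : InternalHom C M) (m : M) : (H.Y m).PreservesEpimorphisms where
  preserves {n n'} f _ := by
    have := enoughProjectives k C
    let P := Projective.over (H.hom m n')
    have : Projective (P ⊙ₗ m) :=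
      ExactModuleCategory.projective_action (k := k) P m inferInstance
    let g : P ⊙ₗ m ⟶ n' := Projective.π (H.hom m n') ⊵ₗ m ≫ H.ieval m n'
    have e : H.curry (Projective.factorThru g f) ≫ (H.Y m).map f = Projective.π (H.hom m n') :=
      hom_ext (by simp [g])
    exact epi_of_epi_fac e

theorem Y_rightExact (k : Type w) [Field k] {C : Type u} [Category.{v} C] [Abelian C] [Linear k C]
    [MonoidalCategory C] [MonoidalPreadditive C] [MonoidalLinear k C] [RigidCategory C]
    [FiniteTensorCategory k C]
    {M : Type u'} [Category.{v'} M] [Abelian M] [Linear k M] [MonoidalLeftAction C M]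
    [ExactModuleCategory k C M] (H : InternalHom C M) (m : M) : PreservesFiniteColimits (H.Y m) := by
  have := H.Y_additive k m
  have := H.Y_preservesEpimorphisms k m
  have := (H.adj m).rightAdjoint_preservesLimits
  have := (H.Y m).preservesHomology_of_preservesEpis_and_kernels
  exact (H.Y m).preservesFiniteColimits_of_preservesHomology

variable (k : Type w) [Field k] {C : Type u} [Category.{v} C] [Abelian C] [Linear k C]
  [MonoidalCategory C] [MonoidalPreadditive C] [MonoidalLinear k C] [RigidCategory C]
  [FiniteTensorCategory k C]
  {M : Type u'} [Category.{v'} M] [Abelian M] [Linear k M] [MonoidalLeftAction C M]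
  [ExactModuleCategory k C M] (H : InternalHom C M)

theorem Y_linear (m : M) : (H.Y m).Linear k where
  map_smul f r := hom_ext (by
    have h := ExactModuleCategory.actionRight_linear (k := k) (C := C) m
    have e {X X' : C} (g : X ⟶ X') : (r • g) ⊵ₗ m = r • (g ⊵ₗ m) := h.map_smul g r
    rw [e, Linear.smul_comp, map_ieval, map_ieval, Linear.comp_smul])

/-- `Y m = [m, -]` as a right exact module functor. -/
@[simps! functor]
def yonedaObj (m : M) : Rex k C M C where
  functor := H.Y m
  lax := H.laxY m
  isIso := isIso_lineator _
  additive := H.Y_additive k m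
  linear := H.Y_linear k m
  rightExact := H.Y_rightExact k m

/-- The morphism of module functors `[m', -] ⟶ [m, -]` given by `f : m ⟶ m'`. -/
def yonedaMap {m m' : M} (f : m ⟶ m') : H.yonedaObj k m' ⟶ H.yonedaObj k m where
  nat := { app n := H.pre f n, naturality _ _ g := H.pre_natural f g }
  comm X n := H.a_pre f X n

/-- The isomorphism of module functors `[m, -] ⊗ X^* ≅ [X ⊙ₗ m, -]`. -/
def yonedaAct (X : C) (m : M) : (H.yonedaObj k m).act (dual X) ≅ H.yonedaObj k (X ⊙ₗ m) :=
  Rex.mkIso (fun n => H.b X (dual X) m n) (fun g => H.b_natural X (dual X) m g)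
    (fun Z n => (Category.assoc _ _ _).trans (H.a_b X (dual X) Z m n))

/-- The Yoneda functor `m ↦ [m, -]`. -/
def yoneda : M ⥤ DualOp C (Rex k C M C) where
  obj m := op (H.yonedaObj k m)
  map f := (H.yonedaMap k f).op
  map_id m := congrArg Quiver.Hom.op (Rex.hom_ext fun n => H.pre_id m n)
  map_comp f g := congrArg Quiver.Hom.op (Rex.hom_ext fun n => H.pre_comp f g n)

theorem iso_square {A B A' B' : C} (e : A ≅ B) (e' : A' ≅ B') (f : A ⟶ A') (g : B ⟶ B')
    (h : f ≫ e'.hom = e.hom ≫ g) : e.inv ≫ f = g ≫ e'.inv := by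
  rw [Iso.inv_comp_eq, ← reassoc_of% h]; simp

instance yonedaLax : (H.yoneda k).LaxLeftLinear C where
  μₗ X m := (H.yonedaAct k X m).inv.op
  μₗ_naturality_left {X X'} f m := congrArg Quiver.Hom.op (Rex.hom_ext fun n =>
    iso_square _ _ _ _ (H.b_dual f m n))
  μₗ_naturality_right X m m' f := congrArg Quiver.Hom.op (Rex.hom_ext fun n =>
    iso_square _ _ _ _ (H.b_pre X (dual X) f n))
  μₗ_associativity X X' m := congrArg Quiver.Hom.op (Rex.hom_ext fun n => by
    have h : H.pre (αₗ X X' m).hom n ≫ (H.b (X ⊗ X') (dual (X ⊗ X')) m n).inv =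
        ((H.b X (dual X) (X' ⊙ₗ m) n).inv ≫ (H.b X' (dual X') m n).inv ▷ dual X) ≫
          (α_ _ _ _).hom ≫ H.hom m n ◁ (dualTensor X X').inv := by
      rw [Iso.comp_inv_eq]
      simp only [Category.assoc, H.b_tensor]
      simp
    exact h)
  μₗ_unitality m := congrArg Quiver.Hom.op (Rex.hom_ext fun n => by
    have h : (ρ_ _).inv ≫ H.hom m n ◁ (dualUnit (C := C)).inv =
        H.pre (λₗ[C] m).hom n ≫ (H.b (𝟙_ C) (dual (𝟙_ C)) m n).inv := by
      rw [Iso.eq_comp_inv, H.b_unit]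
    exact h)

/-- The Yoneda functor as a module functor; its lineator is induced by
`[X ⊙ₗ m, n] ≅ [m, n] ⊗ X^*`. -/
def yonedaModule : ModuleFunctor C M (DualOp C (Rex k C M C)) where
  functor := H.yoneda k
  lax := H.yonedaLax k
  isIso := isIso_lineator _

end InternalHom

end YonedaModuleFunctor

section RightAdjointFunctor

open Functor.LaxLeftLinear MonoidalLeftAction Opposite

variable (k : Type w) [Field k] (C : Type u) [Category.{v} C] [Abelian C] [Linear k C]
  [MonoidalCategory C]
  (M : Type u') [Category.{v'} M] [Abelian M] [Linear k M] [MonoidalLeftAction C M]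

section Lineators

variable {C M} (F : M ⥤ C) [F.LaxLeftLinear C]

theorem lin_natL {X X' : C} (f : X ⟶ X') (m : M) :
    f ▷ F.obj m ≫ μₗ F X' m = μₗ F X m ≫ F.map (f ⊵ₗ m) := μₗ_naturality_left F f m

theorem lin_natR (X : C) {m m' : M} (f : m ⟶ m') :
    X ◁ F.map f ≫ μₗ F X m' = μₗ F X m ≫ F.map (X ⊴ₗ f) := μₗ_naturality_right F X f

theorem lin_assoc (X Y : C) (m : M) : μₗ F (X ⊗ Y) m ≫ F.map (αₗ X Y m).hom =
    (α_ X Y (F.obj m)).hom ≫ X ◁ μₗ F Y m ≫ μₗ F X (Y ⊙ₗ m) := μₗ_associativity F X Y m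

theorem lin_unit (m : M) : μₗ F (𝟙_ C) m ≫ F.map (λₗ[C] m).hom = (λ_ (F.obj m)).hom :=
  (μₗ_unitality F m).symm

end Lineators

/-- A choice of right adjoints of the right exact module functors `M ⥤ C`. -/
structure RightAdjoints where
  ra (F : Rex k C M C) : C ⥤ M
  adj (F : Rex k C M C) : F.functor ⊣ ra F

variable {k C M}

namespace RightAdjoints

variable (R : RightAdjoints k C M)

/-- The counit of the adjunction. -/
def counit (F : Rex k C M C) (V : C) : F.functor.obj ((R.ra F).obj V) ⟶ V := (R.adj F).counit.app V

/-- The adjunction bijection. -/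
def lift (F : Rex k C M C) {m : M} {V : C} (f : F.functor.obj m ⟶ V) : m ⟶ (R.ra F).obj V :=
  (R.adj F).homEquiv m V f

@[simp]
theorem lift_counit (F : Rex k C M C) {m : M} {V : C} (f : F.functor.obj m ⟶ V) :
    F.functor.map (R.lift F f) ≫ R.counit F V = f :=
  ((R.adj F).homEquiv_counit m V _).symm.trans (((R.adj F).homEquiv m V).symm_apply_apply f)

@[simp]
theorem lift_counit_assoc (F : Rex k C M C) {m : M} {V W : C} (f : F.functor.obj m ⟶ V)
    (h : V ⟶ W) : F.functor.map (R.lift F f) ≫ R.counit F V ≫ h = f ≫ h := by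
  rw [reassoc_of% R.lift_counit F f]

variable {R} in
theorem hom_ext {F : Rex k C M C} {m : M} {V : C} {f g : m ⟶ (R.ra F).obj V}
    (h : F.functor.map f ≫ R.counit F V = F.functor.map g ≫ R.counit F V) : f = g :=
  ((R.adj F).homEquiv m V).symm.injective
    (((R.adj F).homEquiv_counit m V f).trans (h.trans ((R.adj F).homEquiv_counit m V g).symm))

@[simp]
theorem map_counit (F : Rex k C M C) {V W : C} (f : V ⟶ W) :
    F.functor.map ((R.ra F).map f) ≫ R.counit F W = R.counit F V ≫ f :=
  (R.adj F).counit.naturality f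

@[simp]
theorem map_counit_assoc (F : Rex k C M C) {V W Z : C} (f : V ⟶ W) (h : W ⟶ Z) :
    F.functor.map ((R.ra F).map f) ≫ R.counit F W ≫ h = R.counit F V ≫ f ≫ h := by
  rw [reassoc_of% R.map_counit F f]

/-- The canonical lineator of a right adjoint. -/
def lineator (F : Rex k C M C) (X V : C) :
    X ⊙ₗ (R.ra F).obj V ⟶ (R.ra F).obj (X ⊗ V) :=
  R.lift F (inv (μₗ F.functor X _) ≫ X ◁ R.counit F V)

theorem lineator_counit' (F : Rex k C M C) (X V : C) :
    F.functor.map (R.lineator F X V) ≫ R.counit F (X ⊗ V) =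
      inv (μₗ F.functor X _) ≫ X ◁ R.counit F V := R.lift_counit F _

theorem lineator_counit (F : Rex k C M C) (X V : C) :
    μₗ F.functor X _ ≫ F.functor.map (R.lineator F X V) ≫ R.counit F (X ⊗ V) =
      X ◁ R.counit F V := by
  rw [lineator_counit', IsIso.hom_inv_id_assoc]

variable {R} in
theorem hom_ext' {F : Rex k C M C} {X : C} {m : M} {V : C} {f g : X ⊙ₗ m ⟶ (R.ra F).obj V}
    (h : μₗ F.functor X m ≫ F.functor.map f ≫ R.counit F V =
      μₗ F.functor X m ≫ F.functor.map g ≫ R.counit F V) : f = g :=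
  hom_ext ((cancel_epi (μₗ F.functor X m)).1 h)

theorem lineator_natL (F : Rex k C M C) {X X' : C} (f : X ⟶ X') (V : C) :
    f ⊵ₗ (R.ra F).obj V ≫ R.lineator F X' V = R.lineator F X V ≫ (R.ra F).map (f ▷ V) :=
  hom_ext' (by
    rw [Functor.map_comp, Functor.map_comp, Category.assoc, Category.assoc, ← reassoc_of% lin_natL,
      lineator_counit, map_counit, reassoc_of% lineator_counit, whisker_exchange])

theorem lineator_natR (F : Rex k C M C) (X : C) {V W : C} (f : V ⟶ W) :
    X ⊴ₗ (R.ra F).map f ≫ R.lineator F X W = R.lineator F X V ≫ (R.ra F).map (X ◁ f) :=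
  hom_ext' (by
    rw [Functor.map_comp, Functor.map_comp, Category.assoc, Category.assoc, ← reassoc_of% lin_natR,
      lineator_counit, map_counit, reassoc_of% lineator_counit, ← MonoidalCategory.whiskerLeft_comp,
      map_counit, MonoidalCategory.whiskerLeft_comp])

theorem lineator_assoc (F : Rex k C M C) (X X' V : C) :
    R.lineator F (X ⊗ X') V ≫ (R.ra F).map (α_ X X' V).hom =
      (αₗ X X' ((R.ra F).obj V)).hom ≫ X ⊴ₗ R.lineator F X' V ≫ R.lineator F X (X' ⊗ V) :=
  hom_ext' (by
    simp only [Functor.map_comp, Category.assoc]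
    rw [map_counit, reassoc_of% lineator_counit, reassoc_of% lin_assoc, ← reassoc_of% lin_natR, lineator_counit,
      ← MonoidalCategory.whiskerLeft_comp, ← MonoidalCategory.whiskerLeft_comp, lineator_counit]
    simp)

theorem lineator_unit (F : Rex k C M C) (V : C) :
    (λₗ[C] ((R.ra F).obj V)).hom = R.lineator F (𝟙_ C) V ≫ (R.ra F).map (λ_ V).hom :=
  hom_ext' (by
    rw [Functor.map_comp, Category.assoc, map_counit, reassoc_of% lineator_counit, reassoc_of% lin_unit]
    simp)

instance laxRa (F : Rex k C M C) : (R.ra F).LaxLeftLinear C where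
  μₗ X V := R.lineator F X V
  μₗ_naturality_left f V := R.lineator_natL F f V
  μₗ_naturality_right X _ _ f := R.lineator_natR F X f
  μₗ_associativity X X' V := R.lineator_assoc F X X' V
  μₗ_unitality V := R.lineator_unit F V

theorem ra_linear (F : Rex k C M C) : (R.ra F).Linear k where
  map_smul f r := hom_ext (by
    have := F.linear
    rw [map_counit, Functor.map_smul, Linear.smul_comp, map_counit, Linear.comp_smul])

variable [RigidCategory C]

/-- The right adjoint as a left exact module functor. -/
@[simps! functor]
def raObj (F : Rex k C M C) : Lex k C C M where
  functor := R.ra F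
  lax := R.laxRa F
  isIso := isIso_lineator _
  additive := have := F.additive; (R.adj F).right_adjoint_additive
  linear := R.ra_linear F
  leftExact := have := (R.adj F).rightAdjoint_preservesLimits; inferInstance

/-- A morphism `F ⟶ F'` induces a morphism between right adjoints in the other direction. -/
def conj {F F' : Rex k C M C} (t : F ⟶ F') (V : C) : (R.ra F').obj V ⟶ (R.ra F).obj V :=
  R.lift F (t.nat.app _ ≫ R.counit F' V)

@[simp]
theorem conj_counit {F F' : Rex k C M C} (t : F ⟶ F') (V : C) :
    F.functor.map (R.conj t V) ≫ R.counit F V = t.nat.app _ ≫ R.counit F' V := R.lift_counit F _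

@[simp]
theorem conj_counit_assoc {F F' : Rex k C M C} (t : F ⟶ F') {V W : C} (h : V ⟶ W) :
    F.functor.map (R.conj t V) ≫ R.counit F V ≫ h = t.nat.app _ ≫ R.counit F' V ≫ h := by
  rw [reassoc_of% R.conj_counit t V]

theorem conj_natural {F F' : Rex k C M C} (t : F ⟶ F') {V W : C} (f : V ⟶ W) :
    (R.ra F').map f ≫ R.conj t W = R.conj t V ≫ (R.ra F).map f := hom_ext (by simp)

theorem conj_lineator {F F' : Rex k C M C} (t : F ⟶ F') (X V : C) :
    R.lineator F' X V ≫ R.conj t (X ⊗ V) = X ⊴ₗ R.conj t V ≫ R.lineator F X V := hom_ext' (by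
  have h : ∀ m, μₗ F.functor X m ≫ t.nat.app (X ⊙ₗ m) = X ◁ t.nat.app m ≫ μₗ F'.functor X m :=
    t.comm X
  simp only [Functor.map_comp, Category.assoc]
  rw [conj_counit, t.nat.naturality_assoc, reassoc_of% h, lineator_counit, ← reassoc_of% lin_natR,
    lineator_counit, ← MonoidalCategory.whiskerLeft_comp, ← MonoidalCategory.whiskerLeft_comp,
    conj_counit])

theorem conj_id (F : Rex k C M C) (V : C) : R.conj (𝟙 F) V = 𝟙 _ := hom_ext (by simp)

theorem conj_comp {F F' F'' : Rex k C M C} (s : F ⟶ F') (t : F' ⟶ F'') (V : C) :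
    R.conj (s ≫ t) V = R.conj t V ≫ R.conj s V := hom_ext (by simp)

/-- The morphism of module functors between right adjoints. -/
def raMap {F F' : Rex k C M C} (t : F ⟶ F') : R.raObj F' ⟶ R.raObj F where
  nat := { app V := R.conj t V
           naturality _ _ f := R.conj_natural t f }
  comm X V := R.conj_lineator t X V

variable [MonoidalPreadditive C] [MonoidalLinear k C]

/-- Taking right adjoints. -/
def raFunctor : DualOp C (Rex k C M C) ⥤ Twist (doubleDual C) (Lex k C C M) where
  obj F := R.raObj (unop F)
  map t := R.raMap t.unop
  map_id F := Lex.hom_ext fun V => R.conj_id (unop F) V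
  map_comp s t := Lex.hom_ext fun V => R.conj_comp t.unop s.unop V

/-- The component `F^ra (V ⊗ X^**) ⟶ (F(-) ⊗ X^*)^ra V` of the lineator. -/
def actComp (X : C) (F : Rex k C M C) (V : C) :
    (R.ra F).obj (V ⊗ dual (dual X)) ⟶ (R.ra (F.act (dual X))).obj V :=
  R.lift (F.act (dual X))
    (R.counit F _ ▷ dual X ≫ InternalHom.contr (dual X) (dual (dual X)) V)

/-- The counit for the right adjoint of `F(-) ⊗ X`. -/
def actCounit (F : Rex k C M C) (X V : C) :
    F.functor.obj ((R.ra (F.act X)).obj V) ⊗ X ⟶ V := R.counit (F.act X) V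

/-- The counit for the right adjoint of `(F(-) ⊗ X) ⊗ Y`. -/
def actCounit₂ (F : Rex k C M C) (X Y V : C) :
    (F.functor.obj ((R.ra ((F.act X).act Y)).obj V) ⊗ X) ⊗ Y ⟶ V := R.counit ((F.act X).act Y) V

theorem actComp_counit (X : C) (F : Rex k C M C) (V : C) :
    F.functor.map (R.actComp X F V) ▷ dual X ≫ R.actCounit F (dual X) V =
    R.counit F _ ▷ dual X ≫ InternalHom.contr (dual X) (dual (dual X)) V :=
  R.lift_counit (F.act (dual X)) _

theorem actComp_counit₂ (X : C) (F : Rex k C M C) (X' V : C) :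
    F.functor.map (R.actComp X (F.act X') V) ▷ X' ▷ dual X ≫ R.actCounit₂ F X' (dual X) V =
    R.actCounit F X' _ ▷ dual X ≫ InternalHom.contr (dual X) (dual (dual X)) V :=
  R.actComp_counit X (F.act X') V

theorem act_map_counit (F : Rex k C M C) (X : C) {V W : C} (f : V ⟶ W) :
    F.functor.map ((R.ra (F.act X)).map f) ▷ X ≫ R.actCounit F X W = R.actCounit F X V ≫ f :=
  R.map_counit (F.act X) f

theorem act_lineator_counit (F : Rex k C M C) (X Z V : C) :
    (α_ _ _ _).inv ≫ μₗ F.functor Z _ ▷ X ≫ F.functor.map (R.lineator (F.act X) Z V) ▷ X ≫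
      R.actCounit F X (Z ⊗ V) = Z ◁ R.actCounit F X V :=
  (Category.assoc _ _ _).symm.trans (R.lineator_counit (F.act X) Z V)

variable {R} in
theorem act_ext {F : Rex k C M C} {X V : C} {m : M} {f g : m ⟶ (R.ra (F.act X)).obj V}
    (h : F.functor.map f ▷ X ≫ R.actCounit F X V = F.functor.map g ▷ X ≫ R.actCounit F X V) :
    f = g := hom_ext h

variable {R} in
theorem act_ext₂ {F : Rex k C M C} {X Y V : C} {m : M} {f g : m ⟶ (R.ra ((F.act X).act Y)).obj V}
    (h : F.functor.map f ▷ X ▷ Y ≫ R.actCounit₂ F X Y V =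
      F.functor.map g ▷ X ▷ Y ≫ R.actCounit₂ F X Y V) :
    f = g := hom_ext h

variable {R} in
theorem act_ext' {F : Rex k C M C} {X V Z : C} {m : M} {f g : Z ⊙ₗ m ⟶ (R.ra (F.act X)).obj V}
    (h : (α_ _ _ _).inv ≫ μₗ F.functor Z m ▷ X ≫ F.functor.map f ▷ X ≫ R.actCounit F X V =
      (α_ _ _ _).inv ≫ μₗ F.functor Z m ▷ X ≫ F.functor.map g ▷ X ≫ R.actCounit F X V) :
    f = g := hom_ext' ((Category.assoc _ _ _).trans (h.trans (Category.assoc _ _ _).symm))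

theorem actComp_natural (X : C) (F : Rex k C M C) {V W : C} (f : V ⟶ W) :
    (R.ra F).map (f ▷ dual (dual X)) ≫ R.actComp X F W =
      R.actComp X F V ≫ (R.ra (F.act (dual X))).map f := act_ext (by
  simp only [Functor.map_comp, comp_whiskerRight, Category.assoc]
  rw [actComp_counit, act_map_counit, reassoc_of% actComp_counit, ← comp_whiskerRight_assoc, map_counit,
    comp_whiskerRight_assoc, InternalHom.contr_natural])

theorem actComp_lineator (X : C) (F : Rex k C M C) (Z V : C) :
    (R.lineator F Z (V ⊗ dual (dual X)) ≫ (R.ra F).map (α_ Z V _).inv) ≫ R.actComp X F (Z ⊗ V) =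
      Z ⊴ₗ R.actComp X F V ≫ R.lineator (F.act (dual X)) Z V := act_ext' (by
  have h := congrArg (fun t => (α_ _ _ _).inv ≫ t ▷ dual X)
    (lin_natR F.functor Z (R.actComp X F V))
  simp only [comp_whiskerRight] at h
  have h2 := InternalHom.contr_tensor_left (dual X) (dual (dual X)) Z V
  have h4 := congrArg (fun t => t ▷ dual X) (R.lineator_counit F Z (V ⊗ dual (dual X)))
  simp only [comp_whiskerRight] at h4
  simp only [Functor.map_comp, comp_whiskerRight, Category.assoc]
  rw [actComp_counit, ← reassoc_of% h, ← comp_whiskerRight_assoc _ (R.counit F _), map_counit,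
    comp_whiskerRight_assoc, reassoc_of% h4, h2, ← associator_inv_naturality_middle_assoc,
    ← associator_inv_naturality_middle_assoc, act_lineator_counit, ← MonoidalCategory.whiskerLeft_comp, actComp_counit]
  simp)

/-- The natural morphism `F^ra (- ⊗ X^**) ⟶ (F(-) ⊗ X^*)^ra` of module functors. -/
def raAct (X : C) (F : Rex k C M C) :
    Lex.act (dual (dual X)) (R.raObj F) ⟶ R.raObj (F.act (dual X)) where
  nat := { app V := R.actComp X F V
           naturality _ _ f := R.actComp_natural X F f }
  comm Z V := R.actComp_lineator X F Z V

theorem act_conj_counit {F G : Rex k C M C} {X Y : C} (t : F.act X ⟶ G.act Y) (V : C) :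
    F.functor.map (R.conj t V) ▷ X ≫ R.actCounit F X V = t.nat.app _ ≫ R.actCounit G Y V :=
  R.conj_counit t V

theorem actComp_dual {X X' : C} (f : X ⟶ X') (F : Rex k C M C) (V : C) :
    (R.ra F).map (V ◁ dualMap (dualMap f)) ≫ R.actComp X' F V =
      R.actComp X F V ≫ R.conj (MonoidalRightAction.actionHomRight F (dualMap f)) V := act_ext (by
  have h : F.functor.map
      (R.conj (MonoidalRightAction.actionHomRight F (dualMap f)) V) ▷ dual X' ≫
      R.actCounit F (dual X') V = _ ◁ dualMap f ≫ R.actCounit F (dual X) V :=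
    R.act_conj_counit (MonoidalRightAction.actionHomRight F (dualMap f)) V
  simp only [Functor.map_comp, comp_whiskerRight, Category.assoc]
  rw [actComp_counit, h, ← whisker_exchange_assoc, actComp_counit, ← comp_whiskerRight_assoc,
    map_counit, comp_whiskerRight_assoc, whisker_exchange_assoc, InternalHom.contr_dual])

theorem actComp_conj (X : C) {F G : Rex k C M C} (t : F ⟶ G) (V : C) :
    R.conj t (V ⊗ dual (dual X)) ≫ R.actComp X F V =
      R.actComp X G V ≫ R.conj (MonoidalRightAction.actionHomLeft t (dual X)) V := act_ext (by
  have h : F.functor.map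
      (R.conj (MonoidalRightAction.actionHomLeft t (dual X)) V) ▷ dual X ≫
      R.actCounit F (dual X) V = t.nat.app _ ▷ dual X ≫ R.actCounit G (dual X) V :=
    R.act_conj_counit (MonoidalRightAction.actionHomLeft t (dual X)) V
  simp only [Functor.map_comp, comp_whiskerRight, Category.assoc]
  rw [actComp_counit, h, ← comp_whiskerRight_assoc, ← comp_whiskerRight_assoc, conj_counit,
    t.nat.naturality, comp_whiskerRight_assoc, comp_whiskerRight_assoc, actComp_counit])

theorem contr_doubleDual (X X' V : C) :
    (α_ _ _ _).hom ≫ (V ⊗ dual (dual (X ⊗ X'))) ◁ (dualTensor X X').inv ≫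
        InternalHom.contr (dual (X ⊗ X')) (dual (dual (X ⊗ X'))) V =
      (V ◁ (doubleDualTensor X X').inv ≫ (α_ _ _ _).inv) ▷ dual X' ▷ dual X ≫
        InternalHom.contr (dual X') (dual (dual X')) (V ⊗ dual (dual X)) ▷ dual X ≫
          InternalHom.contr (dual X) (dual (dual X)) V := by
  have h : (doubleDualTensor X X').inv =
    dualMap (dualTensor X X').inv ≫ (dualTensor (dual X') (dual X)).hom := rfl
  have h1 := InternalHom.contr_tensor (dual X') (dual X) V
  rw [Iso.eq_inv_comp] at h1
  have h2 := InternalHom.contr_dual (dualTensor X X').inv V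
  rw [comp_whiskerRight, comp_whiskerRight, Category.assoc, ← h1, ← h2, h]
  simp only [MonoidalCategory.whiskerLeft_comp, comp_whiskerRight, Category.assoc]
  rw [associator_naturality_left_assoc ((α_ V (dual (dual X)) (dual (dual X'))).inv),
    associator_naturality_left_assoc, associator_naturality_left_assoc,
    ← comp_whiskerRight_assoc (α_ V (dual (dual X)) (dual (dual X'))).inv, Iso.inv_hom_id,
    id_whiskerRight, Category.id_comp, ← comp_whiskerRight_assoc (V ◁ (dualTensor _ _).hom),
    ← MonoidalCategory.whiskerLeft_comp, Iso.hom_inv_id]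
  simp

theorem actComp_assoc (X X' : C) (F : Rex k C M C) (V : C) :
    R.actComp (X ⊗ X') F V ≫ R.conj (dualActAssoc X X' F).inv V =
      ((R.ra F).map (V ◁ (doubleDualTensor X X').inv) ≫ (R.ra F).map (α_ _ _ _).inv) ≫
        R.actComp X' F (V ⊗ dual (dual X)) ≫ R.actComp X (F.act (dual X')) V := act_ext₂ (by
  have h : F.functor.map (R.conj (dualActAssoc X X' F).inv V) ▷ dual X' ▷ dual X ≫
      R.actCounit₂ F (dual X') (dual X) V = ((α_ _ _ _).hom ≫ _ ◁ (dualTensor X X').inv) ≫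
        R.actCounit F (dual (X ⊗ X')) V :=
    R.conj_counit (dualActAssoc X X' F).inv V
  simp only [Functor.map_comp, comp_whiskerRight, Category.assoc]
  rw [actComp_counit₂, h]
  have e : ∀ {A A' : C} (f : A ⟶ A'), f ▷ dual X' ▷ dual X ≫
    (α_ _ _ _).hom ≫ _ ◁ (dualTensor X X').inv = ((α_ _ _ _).hom ≫ _ ◁ (dualTensor X X').inv) ≫
      f ▷ dual (X ⊗ X') := by
    intro A A' f
    rw [Category.assoc, whisker_exchange, associator_naturality_left_assoc]
  have e' := e (F.functor.map (R.actComp (X ⊗ X') F V)) =≫ R.actCounit F (dual (X ⊗ X')) V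
  simp only [Category.assoc] at e' ⊢
  rw [e', actComp_counit, ← comp_whiskerRight_assoc (_ ▷ _) (R.actCounit F _ _), actComp_counit]
  have e'' := e (R.counit F (V ⊗ dual (dual (X ⊗ X')))) =≫
    InternalHom.contr (dual (X ⊗ X')) (dual (dual (X ⊗ X'))) V
  simp only [Category.assoc] at e''
  rw [← e'', contr_doubleDual]
  simp only [comp_whiskerRight, Category.assoc]
  simp only [← comp_whiskerRight_assoc]
  rw [map_counit, map_counit_assoc])

theorem contr_doubleDual_unit (V : C) :
    V ◁ (doubleDualUnit (C := C)).inv ≫ (ρ_ V).hom = (ρ_ _).inv ≫ _ ◁ dualUnit.inv ≫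
      InternalHom.contr (dual (𝟙_ C)) (dual (dual (𝟙_ C))) V := by
  have h : (doubleDualUnit (C := C)).inv = dualMap dualUnit.inv ≫ dualUnit.hom := rfl
  have h1 := InternalHom.contr_unit V
  have h2 := InternalHom.contr_dual (dualUnit (C := C)).inv V
  have h3 : V ◁ dualMap (dualUnit (C := C)).inv =
      (V ◁ (doubleDualUnit (C := C)).inv ≫ (ρ_ V).hom) ≫ (ρ_ V).inv ≫ V ◁ dualUnit.inv := by
    rw [h]
    simp [← MonoidalCategory.whiskerLeft_comp]
  rw [← h2, h3, comp_whiskerRight, Category.assoc, h1]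
  simp

theorem actComp_unit (F : Rex k C M C) (V : C) :
    (R.ra F).map (V ◁ (doubleDualUnit (C := C)).inv) ≫ (R.ra F).map (ρ_ V).hom =
      R.actComp (𝟙_ C) F V ≫ R.conj (dualActUnit (C := C) F).inv V := hom_ext (by
  have h : F.functor.map (R.conj (dualActUnit (C := C) F).inv V) ≫ R.counit F V =
      ((ρ_ _).inv ≫ _ ◁ dualUnit.inv) ≫ R.actCounit F (dual (𝟙_ C)) V :=
    R.conj_counit (dualActUnit (C := C) F).inv V
  simp only [Functor.map_comp, Category.assoc]
  rw [h, map_counit, map_counit_assoc, contr_doubleDual_unit]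
  simp only [Category.assoc]
  rw [rightUnitor_inv_naturality_assoc, rightUnitor_inv_naturality_assoc,
    ← whisker_exchange_assoc, ← whisker_exchange_assoc, actComp_counit])

instance raLax : R.raFunctor.LaxLeftLinear C where
  μₗ X F := R.raAct X (unop F)
  μₗ_naturality_left f F := Lex.hom_ext fun V => R.actComp_dual f (unop F) V
  μₗ_naturality_right X _ _ t := Lex.hom_ext fun V => R.actComp_conj X t.unop V
  μₗ_associativity X X' F := Lex.hom_ext fun V => R.actComp_assoc X X' (unop F) V
  μₗ_unitality F := Lex.hom_ext fun V => R.actComp_unit (unop F) V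

/-- Taking right adjoints, as a module functor. -/
def raModule : ModuleFunctor C (DualOp C (Rex k C M C)) (Twist (doubleDual C) (Lex k C C M)) where
  functor := R.raFunctor
  lax := R.raLax
  isIso := isIso_lineator _

end RightAdjoints

end RightAdjointFunctor

section Evaluation

open Functor.LaxLeftLinear MonoidalLeftAction Opposite

variable (k : Type w) [Field k] {C : Type u} [Category.{v} C] [Abelian C] [Linear k C]
  [MonoidalCategory C] [MonoidalPreadditive C] [MonoidalLinear k C] [RigidCategory C]
  {M : Type u'} [Category.{v'} M] [Abelian M] [Linear k M] [MonoidalLeftAction C M]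

variable (C M) in
/-- Evaluation of a left exact module functor at the unit object. -/
@[simps]
def evalUnit : Lex k C C M ⥤ M where
  obj G := G.functor.obj (𝟙_ C)
  map a := a.nat.app (𝟙_ C)

variable (C M) in
/-- The lineator `X ⊙ₗ G 1 ⟶ G (X ⊗ 1) ≅ G X ≅ G (1 ⊗ X) = (X ⊙ₗ G) 1`. -/
instance evalUnitLax : (evalUnit k C M).LaxLeftLinear C where
  μₗ X G := μₗ G.functor X (𝟙_ C) ≫ G.functor.map ((ρ_ X).hom ≫ (λ_ X).inv)
  μₗ_naturality_left {X X'} f G := by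
    have h : f ⊵ₗ G.functor.obj (𝟙_ C) ≫ μₗ G.functor X' (𝟙_ C) =
      μₗ G.functor X (𝟙_ C) ≫ G.functor.map (f ▷ 𝟙_ C) := μₗ_naturality_left G.functor f (𝟙_ C)
    have h' : f ⊵ₗ G.functor.obj (𝟙_ C) ≫ μₗ G.functor X' (𝟙_ C) ≫
        G.functor.map ((ρ_ X').hom ≫ (λ_ X').inv) =
        (μₗ G.functor X (𝟙_ C) ≫ G.functor.map ((ρ_ X).hom ≫ (λ_ X).inv)) ≫
          G.functor.map (𝟙_ C ◁ f) := by
      rw [reassoc_of% h]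
      simp [← Functor.map_comp]
    exact h'
  μₗ_naturality_right X G G' a := by
    have h : μₗ G.functor X (𝟙_ C) ≫ a.nat.app (X ⊗ 𝟙_ C) =
      X ⊴ₗ a.nat.app (𝟙_ C) ≫ μₗ G'.functor X (𝟙_ C) := a.comm X (𝟙_ C)
    have h' : X ⊴ₗ a.nat.app (𝟙_ C) ≫ μₗ G'.functor X (𝟙_ C) ≫
        G'.functor.map ((ρ_ X).hom ≫ (λ_ X).inv) =
        (μₗ G.functor X (𝟙_ C) ≫ G.functor.map ((ρ_ X).hom ≫ (λ_ X).inv)) ≫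
          a.nat.app (𝟙_ C ⊗ X) := by
      rw [← reassoc_of% h, Category.assoc]
      exact congrArg (μₗ G.functor X (𝟙_ C) ≫ ·) (a.nat.naturality ((ρ_ X).hom ≫ (λ_ X).inv)).symm
    exact h'
  μₗ_associativity X X' G := by
    have h : μₗ G.functor (X ⊗ X') (𝟙_ C) ≫ G.functor.map (α_ X X' (𝟙_ C)).hom =
        (αₗ X X' (G.functor.obj (𝟙_ C))).hom ≫ X ⊴ₗ μₗ G.functor X' (𝟙_ C) ≫
          μₗ G.functor X (X' ⊗ 𝟙_ C) := μₗ_associativity G.functor X X' (𝟙_ C)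
    have h' : (μₗ G.functor (X ⊗ X') (𝟙_ C) ≫
          G.functor.map ((ρ_ (X ⊗ X')).hom ≫ (λ_ (X ⊗ X')).inv)) ≫
            G.functor.map (α_ (𝟙_ C) X X').inv =
        (αₗ X X' (G.functor.obj (𝟙_ C))).hom ≫
          X ⊴ₗ (μₗ G.functor X' (𝟙_ C) ≫ G.functor.map ((ρ_ X').hom ≫ (λ_ X').inv)) ≫
          ((μₗ G.functor X (𝟙_ C ⊗ X') ≫ G.functor.map (α_ X (𝟙_ C) X').inv) ≫
            G.functor.map (((ρ_ X).hom ≫ (λ_ X).inv) ▷ X')) := by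
      simp only [MonoidalLeftAction.actionHomRight_comp, Category.assoc]
      have hn : X ⊴ₗ G.functor.map ((ρ_ X').hom ≫ (λ_ X').inv) ≫ μₗ G.functor X (𝟙_ C ⊗ X') =
          μₗ G.functor X (X' ⊗ 𝟙_ C) ≫ G.functor.map (X ◁ ((ρ_ X').hom ≫ (λ_ X').inv)) :=
        μₗ_naturality_right G.functor X ((ρ_ X').hom ≫ (λ_ X').inv)
      rw [reassoc_of% hn, ← reassoc_of% h]
      simp only [← Functor.map_comp]
      congr 2
      monoidal
    exact h'
  μₗ_unitality G := by
    have h : (λₗ[C] (G.functor.obj (𝟙_ C))).hom = μₗ G.functor (𝟙_ C) (𝟙_ C) ≫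
      G.functor.map (λ_ (𝟙_ C)).hom := μₗ_unitality G.functor (𝟙_ C)
    have h' : (λₗ[C] (G.functor.obj (𝟙_ C))).hom = (μₗ G.functor (𝟙_ C) (𝟙_ C) ≫
        G.functor.map ((ρ_ (𝟙_ C)).hom ≫ (λ_ (𝟙_ C)).inv)) ≫ G.functor.map (ρ_ (𝟙_ C)).hom := by
      rw [h, Category.assoc, ← Functor.map_comp]
      congr 2
      monoidal
    exact h'

variable (C M) in
/-- Evaluation at the unit object as a module functor. -/
def evalUnitModule : ModuleFunctor C (Lex k C C M) M where
  functor := evalUnit k C M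
  lax := evalUnitLax k C M
  isIso := isIso_lineator _

variable [FiniteTensorCategory k C] [ExactModuleCategory k C M]
  (H : InternalHom C M) (R : RightAdjoints k C M)

/-- The composite of the Yoneda functor `m ↦ [m, -]`, of the functor taking right adjoints, and
of evaluation at the unit object, as a `(-)^**`-twisted module functor. -/
def yonedaRightAdjointEval : ModuleFunctor C M (Twist (doubleDual C) M) :=
  ((H.yonedaModule k).comp R.raModule).comp ((evalUnitModule k C M).twist (doubleDual C))

end Evaluation

section RelativeSerre

open Functor.LaxLeftLinear MonoidalLeftAction Opposite

section

variable {C : Type u} [Category.{v} C] [MonoidalCategory C] [RigidCategory C]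
  {M : Type u'} [Category.{v'} M] [MonoidalLeftAction C M]

/-- A relative Serre functor: a functor `S` and an isomorphism `[m, n]^* ≅ [n, S m]`, natural in
`m` and `n`. -/
structure RelativeSerreFunctor (H : InternalHom C M) where
  functor : M ⥤ M
  φ (m n : M) : dual (H.hom m n) ≅ H.hom n (functor.obj m)
  naturality_right (m : M) {n n' : M} (f : n ⟶ n') :
    dualMap ((H.Y m).map f) ≫ (φ m n).hom = (φ m n').hom ≫ H.pre f (functor.obj m)
  naturality_left {m m' : M} (f : m ⟶ m') (n : M) :
    dualMap (H.pre f n) ≫ (φ m' n).hom = (φ m n).hom ≫ (H.Y n).map (functor.map f)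

/-- An endofunctor of `M` with values in the module category twisted by `(-)^**`. -/
def toTwist (S : M ⥤ M) : M ⥤ Twist (doubleDual C) M := S

/-- A twisted lineator, as a morphism `X^** ⊙ₗ S m ⟶ S (X ⊙ₗ m)` of `M`. -/
def twistedLineator {S : M ⥤ M} (s : (toTwist (C := C) S).LaxLeftLinear C) (X : C) (m : M) :
    dual (dual X) ⊙ₗ S.obj m ⟶ S.obj (X ⊙ₗ m) :=
  s.μₗ X m

/-- The isomorphism `X^** ⊗ [m, n]^* ≅ ([m, n] ⊗ X^*)^* ≅ [X ⊙ₗ m, n]^*`, the left module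
structure of `[-, -]^*`. -/
def InternalHom.dualLeft (H : InternalHom C M) (X : C) (m n : M) :
    dual (dual X) ⊗ dual (H.hom m n) ≅ dual (H.hom (X ⊙ₗ m) n) :=
  (dualTensor (H.hom m n) (dual X)).symm ≪≫ (dualMapIso (H.b X (dual X) m n)).symm

/-- The isomorphism `[m, n]^* ⊗ X ≅ (^*X ⊗ [m, n])^* ≅ [m, ^*X ⊙ₗ n]^*`, the right module
structure of `[-, -]^*`. -/
def InternalHom.dualRight (H : InternalHom C M) (X : C) (m n : M) :
    dual (H.hom m n) ⊗ X ≅ dual (H.hom m ((ᘁX) ⊙ₗ n)) :=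
  have : IsIso (H.a (ᘁX) m n) := isIso_lineator (H.Y m) (ᘁX) n
  rightDualIso (X := (ᘁX) ⊗ H.hom m n) ExactPairing.tensor (dualPairing _) ≪≫
    (dualMapIso (asIso (H.a (ᘁX) m n))).symm

/-- The condition on a twisted module structure `s` of a relative Serre functor `(S, φ)` that
`φ : [m, n]^* ≅ [n, S m]` is an isomorphism of bimodule functors, where `X` acts on the left by
tensoring with `X^**`. -/
structure RelativeSerreFunctor.IsBimoduleIso {H : InternalHom C M} (S : RelativeSerreFunctor H)
    (s : (toTwist (C := C) S.functor).LaxLeftLinear C) : Prop where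
  left (X : C) (m n : M) :
    dual (dual X) ◁ (S.φ m n).hom ≫ H.a (dual (dual X)) n (S.functor.obj m) ≫
        (H.Y n).map (twistedLineator s X m) =
      (H.dualLeft X m n).hom ≫ (S.φ (X ⊙ₗ m) n).hom
  right (X : C) (m n : M) :
    (S.φ m n).hom ▷ X ≫ (H.b (ᘁX) X n (S.functor.obj m)).hom =
      (H.dualRight X m n).hom ≫ (S.φ m ((ᘁX) ⊙ₗ n)).hom

/-- A relative Serre functor together with a twisted lineator, as a module functor from `M` to `M`
twisted by `(-)^**`. -/
def RelativeSerreFunctor.toModuleFunctor {H : InternalHom C M} (S : RelativeSerreFunctor H)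
    (s : (toTwist (C := C) S.functor).LaxLeftLinear C) :
    ModuleFunctor C M (Twist (doubleDual C) M) where
  functor := toTwist S.functor
  lax := s
  isIso X m := @isIso_lineator _ _ _ _ _ _ _ _ _ _ (toTwist S.functor) s X m

/-- The bijection `Hom(X, A^*) ≃ Hom(X ⊗ A, 1)`. -/
def dualEquiv (X A : C) : (X ⟶ dual A) ≃ (X ⊗ A ⟶ 𝟙_ C) where
  toFun f := f ▷ A ≫ ev A
  invFun g := 𝟙 _ ⊗≫ X ◁ η_ A (dual A) ⊗≫ g ▷ dual A ⊗≫ 𝟙 _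
  left_inv f := (dual_recover f).symm
  right_inv g := by
    calc _ = 𝟙 _ ⊗≫ (X ◁ η_ A (dual A) ▷ A ⊗≫ (g ▷ (dual A ⊗ A) ≫ 𝟙_ C ◁ ε_ A (dual A))) ⊗≫ 𝟙 _ := by
          rw [ev]; monoidal
      _ = 𝟙 _ ⊗≫ X ◁ (η_ A (dual A) ▷ A ⊗≫ A ◁ ε_ A (dual A)) ⊗≫ g := by
          rw [← whisker_exchange]; monoidal
      _ = g := by
          rw [ExactPairing.evaluation_coevaluation'']; monoidal

end

variable (k : Type w) [Field k] {C : Type u} [Category.{v} C] [Abelian C] [Linear k C]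
  [MonoidalCategory C] [MonoidalPreadditive C] [MonoidalLinear k C] [RigidCategory C]
  [FiniteTensorCategory k C]
  {M : Type u'} [Category.{v'} M] [Abelian M] [Linear k M] [MonoidalLeftAction C M]
  [ExactModuleCategory k C M] (H : InternalHom C M) (R : RightAdjoints k C M)

/-- The functor `m ↦ Y_m^ra 1`. -/
@[simps]
def standardSerreFunctor : M ⥤ M where
  obj m := (R.ra (H.yonedaObj k m)).obj (𝟙_ C)
  map f := R.conj (H.yonedaMap k f) (𝟙_ C)
  map_id m := by
    rw [← R.conj_id]
    congr 1
    exact Rex.hom_ext fun n => H.pre_id m n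
  map_comp f g := by
    rw [← R.conj_comp]
    congr 1
    exact Rex.hom_ext fun n => H.pre_comp f g n

/-- The bijections
`Hom(X, [m, n]^*) ≃ Hom(X ⊗ [m, n], 1) ≃ Hom([m, X ⊙ₗ n], 1) ≃ Hom(X ⊙ₗ n, Y_m^ra 1)
≃ Hom(X, [n, Y_m^ra 1])`. -/
def serreEquiv (X : C) (m n : M) : (X ⟶ dual (H.hom m n)) ≃
    (X ⟶ H.hom n ((standardSerreFunctor k H R).obj m)) :=
  have : IsIso (H.a X m n) := isIso_lineator (H.Y m) X n
  (dualEquiv X (H.hom m n)).trans <|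
    ((asIso (H.a X m n)).homCongr (Iso.refl (𝟙_ C))).trans <|
      ((R.adj (H.yonedaObj k m)).homEquiv (X ⊙ₗ n) (𝟙_ C)).trans <|
        (H.adj n).homEquiv X _

/-- The counit `[m, Y_m^ra 1] ⟶ 1`. -/
def serreCounit (m : M) : H.hom m ((standardSerreFunctor k H R).obj m) ⟶ 𝟙_ C :=
  R.counit (H.yonedaObj k m) (𝟙_ C)

/-- The morphism `X ⊗ [m, n] ⟶ 1` corresponding to `h : X ⟶ [n, Y_m^ra 1]`. -/
def serrePairing {X : C} {m n : M}
    (h : X ⟶ H.hom n ((standardSerreFunctor k H R).obj m)) : X ⊗ H.hom m n ⟶ 𝟙_ C :=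
  H.a X m n ≫ (H.Y m).map (h ⊵ₗ n ≫ H.ieval n _) ≫ serreCounit k H R m

theorem serrePairing_serreEquiv {X : C} {m n : M} (g : X ⟶ dual (H.hom m n)) :
    serrePairing k H R (serreEquiv k H R X m n g) = g ▷ H.hom m n ≫ ev _ := by
  have : IsIso (H.a X m n) := isIso_lineator (H.Y m) X n
  let q : H.hom m (X ⊙ₗ n) ⟶ 𝟙_ C := inv (H.a X m n) ≫ (g ▷ H.hom m n ≫ ev _) ≫ 𝟙 _
  let r : X ⊙ₗ n ⟶ (standardSerreFunctor k H R).obj m := R.lift (H.yonedaObj k m) q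
  have h : serreEquiv k H R X m n g = H.curry r := rfl
  have h' : (H.Y m).map r ≫ serreCounit k H R m = q :=
    R.lift_counit (H.yonedaObj k m) q
  rw [h, serrePairing, InternalHom.curry_ieval, h']
  simp [q]

theorem serrePairing_injective {X : C} {m n : M}
    {h h' : X ⟶ H.hom n ((standardSerreFunctor k H R).obj m)}
    (e : serrePairing k H R h = serrePairing k H R h') : h = h' := by
  have : IsIso (H.a X m n) := isIso_lineator (H.Y m) X n
  obtain ⟨g, rfl⟩ := (serreEquiv k H R X m n).surjective h
  obtain ⟨g', rfl⟩ := (serreEquiv k H R X m n).surjective h'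
  rw [serrePairing_serreEquiv, serrePairing_serreEquiv] at e
  rw [dual_ext e]

theorem serrePairing_comp {X Z : C} (f : Z ⟶ X) {m n : M}
    (h : X ⟶ H.hom n ((standardSerreFunctor k H R).obj m)) :
    serrePairing k H R (f ≫ h) = f ▷ H.hom m n ≫ serrePairing k H R h := by
  have e : f ▷ H.hom m n ≫ H.a X m n = H.a Z m n ≫ (H.Y m).map (f ⊵ₗ n) :=
    μₗ_naturality_left (H.Y m) f n
  rw [serrePairing, serrePairing, reassoc_of% e, MonoidalLeftAction.comp_actionHomLeft,
    Category.assoc, Functor.map_comp (H.Y m) (f ⊵ₗ n), Category.assoc]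

theorem serreEquiv_natural {X Z : C} (f : Z ⟶ X) (m n : M) (g : X ⟶ dual (H.hom m n)) :
    serreEquiv k H R Z m n (f ≫ g) = f ≫ serreEquiv k H R X m n g := by
  apply serrePairing_injective
  rw [serrePairing_comp, serrePairing_serreEquiv, serrePairing_serreEquiv, comp_whiskerRight,
    Category.assoc]

/-- The isomorphism `[m, n]^* ≅ [n, Y_m^ra 1]` obtained from the bijections above by the Yoneda
lemma. -/
def serreIso (m n : M) : dual (H.hom m n) ≅ H.hom n ((standardSerreFunctor k H R).obj m) :=
  Yoneda.ext _ _ (fun {X} => serreEquiv k H R X m n)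
    (fun {X} => (serreEquiv k H R X m n).symm)
    (fun f => Equiv.symm_apply_apply _ f) (fun f => Equiv.apply_symm_apply _ f)
    (fun f g => serreEquiv_natural k H R f m n g)

theorem serrePairing_serreIso (m n : M) :
    serrePairing k H R (serreIso k H R m n).hom = ev (H.hom m n) := by
  have h : (serreIso k H R m n).hom = serreEquiv k H R _ m n (𝟙 _) := rfl
  rw [h, serrePairing_serreEquiv, id_whiskerRight, Category.id_comp]

/-- The standard relative Serre functor. -/
def standardSerre : RelativeSerreFunctor H where
  functor := standardSerreFunctor k H R
  φ := serreIso k H R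
  naturality_right m {n n'} f := by
    have e : ∀ X, X ◁ (H.Y m).map f ≫ H.a X m n' = H.a X m n ≫ (H.Y m).map (X ⊴ₗ f) :=
      fun X => μₗ_naturality_right (H.Y m) X f
    apply serrePairing_injective
    rw [serrePairing_comp, serrePairing_serreIso, dualMap_ev, ← serrePairing_serreIso k H R,
      serrePairing, serrePairing, reassoc_of% e, MonoidalLeftAction.comp_actionHomLeft,
      Category.assoc, InternalHom.pre_ieval, ← MonoidalLeftAction.action_exchange_assoc]
    simp only [Functor.map_comp, Category.assoc]
  naturality_left {m m'} f n := by
    apply serrePairing_injective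
    have e : (H.Y m').map ((standardSerreFunctor k H R).map f) ≫
        serreCounit k H R m' = H.pre f _ ≫ serreCounit k H R m :=
      R.conj_counit (H.yonedaMap k f) (𝟙_ C)
    rw [serrePairing_comp, serrePairing_serreIso, dualMap_ev, ← serrePairing_serreIso k H R,
      serrePairing, serrePairing, ← reassoc_of% H.a_pre f,
      MonoidalLeftAction.comp_actionHomLeft, Category.assoc, InternalHom.map_ieval,
      ← Category.assoc (_ ⊵ₗ n), Functor.map_comp (H.Y m') _ ((standardSerreFunctor k H R).map f),
      Category.assoc, e, reassoc_of% H.pre_natural f]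

end RelativeSerre


end RelSerre

end

/-! Existence of the adjoints is an Eilenberg-Watts argument. Replace the two finite categories by
finitely generated modules over finite-dimensional algebras. A right exact `k`-linear functor `F`
then has the right adjoint `d ↦ Hom(F B, d)`: a morphism `F X ⟶ d` is determined by its restrictions
along the elements `B ⟶ X`, and every `B`-linear family of such restrictions comes from a morphism,
because `F` preserves a presentation of `X` by a free module (`homEquivOfRightExact`,
`FiniteAbelian.isLeftAdjoint`).

Uniqueness needs only the left compatibility square. In it the lineator `s` appears once, as `[n,
s]`, after isomorphisms, and the other side does not mention `s`. So `[n, s]` is determined for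
every `n`. Taking for `n` the source of `s` recovers `s` itself, by feeding in the unit `1 ⟶ [n,
n]`.

For existence, the functor underlying the composite is `S` on the nose, so the lineator of the
composite is a structure on `S`. It is a product of three morphisms `X^** ▷ Y_m^ra(1) ⟶ Y_m^ra(1 ⊗
X^**) ⟶ (Y_m(-) ⊗ X^*)^ra(1) ⟶ Y_{X ▷ m}^ra(1)`, coming from evaluation, from taking adjoints and
from the Yoneda functor.

Both squares are checked after transposing. A morphism `V ⟶ [n, S m]` becomes a pairing `V ⊗ [m, n]
⟶ 1` (`serrePairing`); this loses no information, and `φ` becomes the evaluation of `[m, n]`. The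
three factors above are adjoint transposes, so the pairing sees them only through counits: the first
moves `X^**` past the counit of `Y_m^ra`, the second contracts `X^**` with `X^*`, the third undoes
`[m, -] ⊗ X^* ≅ [X ▷ m, -]`. Hence both sides of the left square become the nested evaluation `X^**
⊗ [m, n]^* ⊗ [m, n] ⊗ X^* ⟶ 1` (`InternalHom.pairing_left`). The right square does not involve the
lineator; both of its sides become the contraction of `X ⊗ ^*X` inside `[m, n]^* ⊗ X ⊗ ^*X ⊗ [m,
n]`, followed by evaluation (`InternalHom.pairing_right`).

By uniqueness, any structure compatible with `φ` is that of the composite, which gives the asserted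
equality. -/

noncomputable section
namespace RelSerre

/-! ### Right exact linear functors between finite categories have right adjoints. -/

section AdjointFunctor

variable {B : Type w} [Ring B]

/-- The morphism `B ⟶ X`, `b ↦ b • x`. -/
def element (X : FGModuleCat.{w} B) (x : X) : FGModuleCat.of B B ⟶ X :=
  ⟨ModuleCat.ofHom (LinearMap.toSpanSingleton B X x)⟩

theorem element_comp {X Z : FGModuleCat.{w} B} (x : X) (f : X ⟶ Z) :
    element X x ≫ f = element Z (f.hom.hom x) :=
  FGModuleCat.hom_ext (LinearMap.ext_ring (by simp [element]))

/-- The underlying linear map of a morphism, as an additive map. -/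
def toLinearMap (X Z : FGModuleCat.{w} B) : (X ⟶ Z) →+ (X →ₗ[B] Z) where
  toFun f := f.hom.hom
  map_zero' := rfl
  map_add' _ _ := rfl

theorem element_add (X : FGModuleCat.{w} B) (x y : X) :
    element X (x + y) = element X x + element X y :=
  FGModuleCat.hom_ext ((LinearMap.toSpanSingleton_add x y).trans
    (map_add (toLinearMap _ _) (element X x) (element X y)).symm)

/-- As an endomorphism of `B`, the element `b` is right multiplication by `b`. So scaling an element
of `X` is precomposition with a map that does not depend on `X`; this identity makes restriction
along elements `B`-linear. -/
theorem element_smul (X : FGModuleCat.{w} B) (b : B) (x : X) :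
    element X (b • x) = element (FGModuleCat.of B B) b ≫ element X x :=
  FGModuleCat.hom_ext (LinearMap.ext_ring (by simp [element]))

theorem element_one : element (FGModuleCat.of B B) (1 : B) = 𝟙 _ :=
  FGModuleCat.hom_ext (LinearMap.ext_ring (by simp [element]))

variable {D : Type u} [Category.{w} D] [Preadditive D] (F : FGModuleCat.{w} B ⥤ D) [F.Additive]

/-- The left `B`-module structure on `Hom(F B, d)`. -/
abbrev homModule (d : D) : Module B (F.obj (FGModuleCat.of B B) ⟶ d) where
  -- Right multiplications make `F B` a right `B`-module, and the contravariance of `Hom(-, d)`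
  -- turns this into a left action.
  smul b f := F.map (element (FGModuleCat.of B B) b) ≫ f
  one_smul f := by
    change F.map (element (FGModuleCat.of B B) (1 : B)) ≫ f = f
    rw [element_one, F.map_id, Category.id_comp]
  mul_smul b b' f := by
    change F.map (element (FGModuleCat.of B B) (b * b')) ≫ f =
      F.map (element (FGModuleCat.of B B) b) ≫ F.map (element (FGModuleCat.of B B) b') ≫ f
    rw [← smul_eq_mul, element_smul, F.map_comp, Category.assoc]
  smul_zero b := comp_zero
  smul_add b f g := Preadditive.comp_add _ _ _ _ _ _
  add_smul b b' f := by
    change F.map (element (FGModuleCat.of B B) (b + b')) ≫ f =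
      F.map (element (FGModuleCat.of B B) b) ≫ f + F.map (element (FGModuleCat.of B B) b') ≫ f
    rw [element_add, F.map_add, Preadditive.add_comp]
  zero_smul f := by
    change F.map (element (FGModuleCat.of B B) (0 : B)) ≫ f = 0
    have h : element (FGModuleCat.of B B) (0 : B) = 0 :=
      FGModuleCat.hom_ext (LinearMap.ext_ring (by simp [element]))
    rw [h, F.map_zero, zero_comp]

variable {F}

theorem epi_fgModule {X Z : FGModuleCat.{w} B} (p : X ⟶ Z)
    (hp : Function.Surjective p.hom.hom) : Epi p where
  left_cancellation a b h := FGModuleCat.hom_ext (LinearMap.ext fun z => by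
    obtain ⟨y, rfl⟩ := hp z
    exact congrArg (fun t => t.hom.hom y) h)

variable (B) in
/-- The `i`-th coordinate of `B ^ n`. -/
def coordinate (n : ℕ) (i : Fin n) : FGModuleCat.of B (Fin n → B) ⟶ FGModuleCat.of B B :=
  ⟨ModuleCat.ofHom (LinearMap.proj i)⟩

omit [F.Additive] in
-- On `F (B ^ n)` a morphism can be prescribed coordinate by coordinate; its value on `y` is then
-- the combination `∑ y i • h i` for the action `homModule`.
theorem map_element_free {n : ℕ} (y : Fin n → B) {d : D}
    (h : Fin n → (F.obj (FGModuleCat.of B B) ⟶ d)) :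
    F.map (element (FGModuleCat.of B (Fin n → B)) y) ≫
        (∑ i, F.map (coordinate B n i) ≫ h i) =
      ∑ i, F.map (element (FGModuleCat.of B B) (y i)) ≫ h i := by
  rw [Preadditive.comp_sum]
  refine Finset.sum_congr rfl fun i _ => ?_
  rw [← Category.assoc, ← F.map_comp, element_comp]
  rfl

theorem sum_hom_apply {ι : Type*} (t : Finset ι) {X Z : FGModuleCat.{w} B} (f : ι → (X ⟶ Z))
    (x : X) : (∑ i ∈ t, f i).hom.hom x = ∑ i ∈ t, (f i).hom.hom x :=
  (LinearMap.congr_fun (map_sum (toLinearMap X Z) f t) x).trans (LinearMap.sum_apply t _ x)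

theorem free_decomposition (n : ℕ) : 𝟙 (FGModuleCat.of B (Fin n → B)) =
    ∑ i, coordinate B n i ≫
      element (FGModuleCat.of B (Fin n → B)) (Pi.single i (1 : B)) :=
  FGModuleCat.hom_ext (LinearMap.ext fun y => by
    rw [sum_hom_apply]
    exact pi_eq_sum_univ' y)

/-- A surjection `B ^ n ⟶ X` stays an epimorphism under the right exact `F`, and its image under `F`
is a sum of morphisms each factoring through `F` of one element of `X`. So the images under `F` of
the elements are jointly epimorphic, although `F X` itself need not have elements. -/
theorem hom_ext_element [PreservesFiniteColimits F] {X : FGModuleCat.{w} B} {d : D}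
    {f g : F.obj X ⟶ d} (h : ∀ x : X, F.map (element X x) ≫ f = F.map (element X x) ≫ g) :
    f = g := by
  obtain ⟨n, p, hp⟩ := Module.Finite.exists_fin' B X
  let P : FGModuleCat.of B (Fin n → B) ⟶ X := ⟨ModuleCat.ofHom p⟩
  have : Epi P := epi_fgModule P hp
  rw [← cancel_epi (F.map P)]
  have e : F.map P = ∑ i, F.map (coordinate B n i) ≫
      F.map (element X (p (Pi.single i 1))) := by
    rw [← Category.id_comp P, free_decomposition, Preadditive.sum_comp, F.map_sum]
    refine Finset.sum_congr rfl fun i _ => ?_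
    rw [Category.assoc, element_comp, F.map_comp]
    rfl
  rw [e, Preadditive.sum_comp, Preadditive.sum_comp]
  simp only [Category.assoc, h]

theorem exists_desc {X Y Z : FGModuleCat.{w} B} (p : Y ⟶ X) (hp : Function.Surjective p.hom.hom)
    (q : Y ⟶ Z) (h : LinearMap.ker p.hom.hom ≤ LinearMap.ker q.hom.hom) :
    ∃ l : X ⟶ Z, p ≫ l = q := by
  refine ⟨⟨ModuleCat.ofHom ((LinearMap.ker p.hom.hom).liftQ q.hom.hom h ∘ₗ
    (p.hom.hom.quotKerEquivOfSurjective hp).symm.toLinearMap)⟩,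
    FGModuleCat.hom_ext (LinearMap.ext fun y => ?_)⟩
  have e : (p.hom.hom.quotKerEquivOfSurjective hp).symm (p.hom.hom y) =
      (LinearMap.ker p.hom.hom).mkQ y := by
    rw [LinearEquiv.symm_apply_eq]
    rfl
  exact congrArg ((LinearMap.ker p.hom.hom).liftQ q.hom.hom h) e

/-- Present `X` as the cokernel of `K ⟶ B ^ n`. The family `g` defines a morphism on `F (B ^ n)`,
linearity of `g` makes it vanish on `F K`, and `F X` is the cokernel of `F K ⟶ F (B ^ n)`. -/
theorem exists_hom_of_linearMap [IsNoetherianRing B] [PreservesFiniteColimits F]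
    {X : FGModuleCat.{w} B} {d : D}
    (g : letI := homModule F d; X →ₗ[B] (F.obj (FGModuleCat.of B B) ⟶ d)) :
    ∃ f : F.obj X ⟶ d, ∀ x : X, F.map (element X x) ≫ f = g x := by
  let := homModule F d
  obtain ⟨n, p, hp⟩ := Module.Finite.exists_fin' B X
  let P : FGModuleCat.of B (Fin n → B) ⟶ X := ⟨ModuleCat.ofHom p⟩
  -- The kernel is finitely generated because `B` is Noetherian, so the presentation stays inside
  -- the category.
  let K : FGModuleCat B := FGModuleCat.of B (LinearMap.ker p)
  let i : K ⟶ FGModuleCat.of B (Fin n → B) := ⟨ModuleCat.ofHom (LinearMap.ker p).subtype⟩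
  -- The only possible choice: its restriction to the `i`-th basis vector has to be the value of `g`
  -- at the `i`-th generator of `X`.
  let h : F.obj (FGModuleCat.of B (Fin n → B)) ⟶ d :=
    ∑ i, F.map (coordinate B n i) ≫ g (p (Pi.single i 1))
  have hh (y : Fin n → B) : F.map (element (FGModuleCat.of B (Fin n → B)) y) ≫ h = g (p y) := by
    rw [map_element_free]
    have e : p y = ∑ i, y i • p (Pi.single i 1) := by
      conv_lhs => rw [pi_eq_sum_univ' y]
      simp
    rw [e, map_sum]
    exact Finset.sum_congr rfl fun i _ => (map_smul g (y i) _).symm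
  have w : i ≫ P = 0 := FGModuleCat.hom_ext (LinearMap.ext fun x => x.2)
  have : Epi P := epi_fgModule P hp
  have hd {Z : FGModuleCat B} (q : FGModuleCat.of B (Fin n → B) ⟶ Z) (hq : i ≫ q = 0) :
      ∃ l : X ⟶ Z, P ≫ l = q :=
    exists_desc P hp q fun x hx => congrArg (fun t : K ⟶ Z => t.hom.hom ⟨x, hx⟩) hq
  have hc : IsColimit (CokernelCofork.ofπ P w) :=
    CokernelCofork.IsColimit.ofπ _ _ (fun q hq => (hd q hq).choose)
      (fun q hq => (hd q hq).choose_spec)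
      (fun q hq m hm => (cancel_epi P).1 (hm.trans (hd q hq).choose_spec.symm))
  -- Vanishing on `F K` is tested on elements of `K`; there `hh` gives `g (p x) = g 0`.
  have e0 : F.map i ≫ h = 0 := hom_ext_element fun x => by
    rw [← Category.assoc, ← F.map_comp, element_comp, comp_zero]
    refine (hh _).trans ?_
    have : p x.1 = 0 := x.2
    exact (congrArg g this).trans (map_zero g)
  let hF := CokernelCofork.mapIsColimit _ hc F
  let f : F.obj X ⟶ d := hF.desc (CokernelCofork.ofπ h e0)
  have hf : F.map P ≫ f = h := hF.fac (CokernelCofork.ofπ h e0) WalkingParallelPair.one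
  refine ⟨f, fun x => ?_⟩
  obtain ⟨y, rfl⟩ := hp x
  have e : element X (p y) = element (FGModuleCat.of B (Fin n → B)) y ≫ P :=
    (element_comp y P).symm
  rw [e, F.map_comp, Category.assoc, hf]
  exact hh y

variable (F) in
/-- The bijection `Hom(F X, d) ≃ Hom_B(X, Hom(F B, d))`. -/
def homEquivOfRightExact [IsNoetherianRing B] [PreservesFiniteColimits F]
    (X : FGModuleCat.{w} B) (d : D) :
    (F.obj X ⟶ d) ≃ (letI := homModule F d; X →ₗ[B] (F.obj (FGModuleCat.of B B) ⟶ d)) :=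
  letI := homModule F d
  Equiv.ofBijective
    (fun f =>
      { toFun x := F.map (element X x) ≫ f
        map_add' x y := by rw [element_add, F.map_add, Preadditive.add_comp]
        map_smul' b x := by
          rw [element_smul, F.map_comp, Category.assoc]
          rfl })
    -- Injectivity is joint epimorphy of the elements; surjectivity is the extension along a
    -- presentation.
    ⟨fun _ _ h => hom_ext_element fun x => congrArg (fun t => t x) h, fun g => by
      obtain ⟨f, hf⟩ := exists_hom_of_linearMap g
      exact ⟨f, LinearMap.ext hf⟩⟩

/-- The right adjoint is `d ↦ Hom(F B, d)`; the finiteness hypothesis says exactly that its values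
are finitely generated modules. -/
theorem isLeftAdjoint_of_rightExact [IsNoetherianRing B] [PreservesFiniteColimits F]
    (h : ∀ d, letI := homModule F d; Module.Finite B (F.obj (FGModuleCat.of B B) ⟶ d)) :
    F.IsLeftAdjoint := by
  let (d : D) := homModule F d
  exact (Adjunction.adjunctionOfEquivRight
    (fun X d => (homEquivOfRightExact F X d).trans
      (show _ ≃ (X ⟶ FGModuleCat.of B (F.obj (FGModuleCat.of B B) ⟶ d)) from
        { toFun g := ⟨ModuleCat.ofHom g⟩, invFun g := g.hom.hom
          left_inv _ := rfl, right_inv _ := rfl }))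
    -- Naturality in the module variable suffices: the action of the right adjoint on morphisms is
    -- then forced.
    (fun X' X d f g => FGModuleCat.hom_ext (LinearMap.ext fun x => by
      change F.map (element X' x) ≫ F.map f ≫ g = F.map (element X (f.hom.hom x)) ≫ g
      rw [← element_comp, F.map_comp, Category.assoc]))).isLeftAdjoint

/-- Since `F` is `k`-linear, a scalar of `k` acts through `B` as it acts on the Hom space, so a
finite spanning set over `k` also generates over `B`. -/
theorem finite_homModule (k : Type w) [Field k] [Algebra k B] {d : D} [Linear k D]
    [F.Linear k] [Module.Finite k (F.obj (FGModuleCat.of B B) ⟶ d)] :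
    letI := homModule F d; Module.Finite B (F.obj (FGModuleCat.of B B) ⟶ d) := by
  let := homModule F d
  have : IsScalarTower k B (F.obj (FGModuleCat.of B B) ⟶ d) := by
    refine IsScalarTower.of_algebraMap_smul fun r f => ?_
    change F.map (element (FGModuleCat.of B B) (algebraMap k B r)) ≫ f = r • f
    have e : element (FGModuleCat.of B B) (algebraMap k B r) = r • 𝟙 _ :=
      FGModuleCat.hom_ext (LinearMap.ext_ring
        ((one_smul B _).trans (mul_one (algebraMap k B r)).symm))
    rw [e, Functor.map_smul, F.map_id, Linear.smul_comp, Category.id_comp]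
  exact Module.Finite.of_restrictScalars_finite k B _

/-- Modules finite over the finite-dimensional `B` are finite-dimensional over `k`, and `B`-linear
maps embed in the finite-dimensional space of `k`-linear ones. -/
theorem finite_hom_fgModule (k : Type w) [Field k] [Algebra k B] [Module.Finite k B]
    (X Z : FGModuleCat.{w} B) : Module.Finite k (X ⟶ Z) := by
  let : Module k X := Module.compHom X (algebraMap k B)
  let : Module k Z := Module.compHom Z (algebraMap k B)
  have : IsScalarTower k B X := IsScalarTower.of_algebraMap_smul fun _ _ => rfl
  have : IsScalarTower k B Z := IsScalarTower.of_algebraMap_smul fun _ _ => rfl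
  have : Module.Finite k X := Module.Finite.trans B X
  have : Module.Finite k Z := Module.Finite.trans B Z
  let i : (X ⟶ Z) →ₗ[k] (X →ₗ[k] Z) :=
    { toFun f := f.hom.hom.restrictScalars k
      map_add' _ _ := rfl
      map_smul' _ _ := rfl }
  exact Module.Finite.of_injective i fun f g h =>
    FGModuleCat.hom_ext (LinearMap.ext fun x => LinearMap.congr_fun h x)

/-! ### Transport to finite abelian categories; existence of internal Homs and of the adjoints. -/

theorem FiniteAbelian.isLeftAdjoint (k : Type w) [Field k] {A : Type u} [Category.{v} A] [Abelian A]
    [Linear k A] [FiniteAbelian k A] {A' : Type u'} [Category.{v'} A'] [Abelian A']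
    [Linear k A'] [FiniteAbelian k A'] (F : A ⥤ A') [F.Additive] [F.Linear k]
    [PreservesFiniteColimits F] : F.IsLeftAdjoint := by
  obtain ⟨B, _, _, _, e, _, _⟩ := FiniteAbelian.exists_equivalence (k := k) (A := A)
  obtain ⟨B', _, _, _, e', _, _⟩ := FiniteAbelian.exists_equivalence (k := k) (A := A')
  have : IsNoetherianRing B := IsNoetherianRing.of_finite k B
  -- The target is also replaced by modules: this makes the Hom spaces finite-dimensional and puts
  -- them in the universe of `B`.
  have : (e.inverse ⋙ F ⋙ e'.functor).IsLeftAdjoint :=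
    isLeftAdjoint_of_rightExact fun d =>
      have := finite_hom_fgModule k ((e.inverse ⋙ F ⋙ e'.functor).obj (FGModuleCat.of B B)) d
      finite_homModule k
  -- Equivalences are left adjoints and left adjoints compose, so the property passes back to `F`
  -- along this isomorphism.
  let i : e.functor ⋙ (e.inverse ⋙ F ⋙ e'.functor) ⋙ e'.inverse ≅ F :=
    NatIso.ofComponents (fun X => e'.unitIso.symm.app _ ≪≫ F.mapIso (e.unitIso.symm.app X))
      (fun f => by simp)
  exact Functor.isLeftAdjoint_of_iso i

theorem nonempty_internalHom (k : Type w) [Field k] {C : Type u} [Category.{v} C] [Abelian C]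
    [Linear k C] [MonoidalCategory C] [MonoidalPreadditive C] [MonoidalLinear k C]
    [RigidCategory C] [FiniteTensorCategory k C]
    {M : Type u'} [Category.{v'} M] [Abelian M] [Linear k M] [MonoidalLeftAction C M]
    [ExactModuleCategory k C M] : Nonempty (InternalHom C M) := by
  have h (m : M) : (MonoidalLeftAction.actionRight C m).IsLeftAdjoint :=
    have := ExactModuleCategory.actionRight_additive k (C := C) m
    have := ExactModuleCategory.actionRight_linear (k := k) (C := C) m
    have := ExactModuleCategory.actionRight_rightExact k (C := C) m
    have : FiniteAbelian k M := ExactModuleCategory.toFiniteAbelian C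
    FiniteAbelian.isLeftAdjoint k _
  exact ⟨⟨fun m => (MonoidalLeftAction.actionRight C m).rightAdjoint,
    fun m => Adjunction.ofIsLeftAdjoint _⟩⟩

theorem nonempty_rightAdjoints (k : Type w) [Field k] {C : Type u} [Category.{v} C] [Abelian C]
    [Linear k C] [MonoidalCategory C] [MonoidalPreadditive C] [MonoidalLinear k C]
    [RigidCategory C] [FiniteTensorCategory k C]
    {M : Type u'} [Category.{v'} M] [Abelian M] [Linear k M] [MonoidalLeftAction C M]
    [ExactModuleCategory k C M] : Nonempty (RightAdjoints k C M) := by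
  have h (F : Rex k C M C) : F.functor.IsLeftAdjoint :=
    have := F.additive
    have := F.linear
    have := F.rightExact
    have : FiniteAbelian k M := ExactModuleCategory.toFiniteAbelian C
    FiniteAbelian.isLeftAdjoint k _
  exact ⟨⟨fun F => F.functor.rightAdjoint, fun F => Adjunction.ofIsLeftAdjoint _⟩⟩

end AdjointFunctor

/-! ### Uniqueness of the module structure, and the two pairing computations. -/

section RelativeSerreModuleStructure

open Functor.LaxLeftLinear MonoidalLeftAction Opposite

variable {C : Type u} [Category.{v} C] [MonoidalCategory C]
  {M : Type u'} [Category.{v'} M] [MonoidalLeftAction C M]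

instance InternalHom.isIso_a [RigidCategory C] (H : InternalHom C M) (X : C) (m n : M) :
    IsIso (H.a X m n) :=
  isIso_lineator (H.Y m) X n

/-- A form of the Yoneda argument: composing the unit `1 ⟶ [m, m]` with `[m, f]` and evaluating on
`m` gives back `f`. -/
theorem InternalHom.Y_jointly_faithful (H : InternalHom C M) {m n : M} {f g : m ⟶ n}
    (h : (H.Y m).map f = (H.Y m).map g) : f = g := by
  have e (f : m ⟶ n) : H.curry (λₗ[C] m).hom ⊵ₗ m ≫ (H.Y m).map f ⊵ₗ m ≫ H.ieval m n =
      (λₗ[C] m).hom ≫ f := by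
    rw [InternalHom.map_ieval, InternalHom.curry_ieval_assoc]
  rw [← cancel_epi (λₗ[C] m).hom, ← e f, ← e g, h]

theorem laxLeftLinear_ext {N : Type u''} [Category.{v''} N] [MonoidalLeftAction C N] {F : M ⥤ N}
    {s t : F.LaxLeftLinear C} (h : ∀ (X : C) (m : M), s.μₗ X m = t.μₗ X m) : s = t := by
  cases s; cases t
  congr
  funext X m
  exact h X m

variable [RigidCategory C] {H : InternalHom C M}

/-- In the left square, `[n, s]` is preceded by `X^** ⊗ φ` and by the lineator of `[n, -]`, both
invertible, and the opposite side is independent of `s`. -/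
theorem RelativeSerreFunctor.IsBimoduleIso.unique {S : RelativeSerreFunctor H}
    {s t : (toTwist (C := C) S.functor).LaxLeftLinear C} (hs : S.IsBimoduleIso s)
    (ht : S.IsBimoduleIso t) : s = t := by
  refine laxLeftLinear_ext fun X m => H.Y_jointly_faithful ?_
  -- The free object `n` is taken to be the source of the lineator, where `[n, -]` separates
  -- morphisms.
  have h := (hs.left X m (dual (dual X) ⊙ₗ S.functor.obj m)).trans
    (ht.left X m (dual (dual X) ⊙ₗ S.functor.obj m)).symm
  have : IsIso (H.a (dual (dual X)) (dual (dual X) ⊙ₗ S.functor.obj m) (S.functor.obj m)) :=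
    isIso_lineator (H.Y (dual (dual X) ⊙ₗ S.functor.obj m)) (dual (dual X)) (S.functor.obj m)
  rw [cancel_epi, cancel_epi] at h
  exact h

omit [RigidCategory C] in
theorem InternalHom.a_tensor (H : InternalHom C M) (V A : C) (m n : M) :
    H.a (V ⊗ A) m n ≫ (H.Y m).map (αₗ _ _ _).hom =
      (α_ _ _ _).hom ≫ V ◁ H.a A m n ≫ H.a V m (A ⊙ₗ n) :=
  μₗ_associativity (H.Y m) V A n

omit [RigidCategory C] in
theorem InternalHom.a_map (H : InternalHom C M) (V : C) (m : M) {n n' : M} (f : n ⟶ n') :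
    H.a V m n ≫ (H.Y m).map (V ⊴ₗ f) = V ◁ (H.Y m).map f ≫ H.a V m n' :=
  (μₗ_naturality_right (H.Y m) V f).symm

omit [RigidCategory C] in
theorem InternalHom.map_a (H : InternalHom C M) {V W : C} (f : V ⟶ W) (m n : M) :
    H.a V m n ≫ (H.Y m).map (f ⊵ₗ n) = f ▷ _ ≫ H.a W m n :=
  (μₗ_naturality_left (H.Y m) f n).symm

/-- The left square in transposed form. In the application `S`, `W`, `U`, `S'` are the values
`Y_m^ra(1)`, `Y_m^ra(1 ⊗ X^**)`, `(Y_m(-) ⊗ X^*)^ra(1)`, `Y_{X ▷ m}^ra(1)`, the morphisms `l`, `c`,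
`j` are the three factors of the lineator, and the `κ`s are counits. Nothing about adjoints is used
beyond the three counit identities `hl`, `hc`, `hj`: they carry `X^**` outside the pairing of `φ`
and contract it with `X^*`. -/
theorem InternalHom.pairing_left (H : InternalHom C M) (X A : C) (m n : M) {S W U S' : M}
    {l : dual (dual X) ⊙ₗ S ⟶ W} {c : W ⟶ U} {j : U ⟶ S'} {κ : H.hom m S ⟶ 𝟙_ C}
    {κW : H.hom m W ⟶ 𝟙_ C ⊗ dual (dual X)} {κU : H.hom m U ⊗ dual X ⟶ 𝟙_ C}
    {κ' : H.hom (X ⊙ₗ m) S' ⟶ 𝟙_ C} (φ : A ⟶ H.hom n S)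
    (hl : H.a (dual (dual X)) m S ≫ (H.Y m).map l ≫ κW =
      dual (dual X) ◁ κ ≫ (ρ_ _).hom ≫ (λ_ _).inv)
    (hc : (H.Y m).map c ▷ dual X ≫ κU =
      κW ▷ dual X ≫ InternalHom.contr (dual X) (dual (dual X)) (𝟙_ C))
    (hj : (H.b X (dual X) m U).hom ≫ (H.Y (X ⊙ₗ m)).map j ≫ κ' = κU) :
    _ ◁ (H.b X (dual X) m n).hom ≫ H.a (dual (dual X) ⊗ A) (X ⊙ₗ m) n ≫
        (H.Y (X ⊙ₗ m)).map ((dual (dual X) ◁ φ ≫ H.a (dual (dual X)) n S ≫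
          (H.Y n).map (l ≫ c ≫ j)) ⊵ₗ n ≫ H.ieval n S') ≫ κ' =
      𝟙 _ ⊗≫ dual (dual X) ◁ ((H.a A m n ≫ (H.Y m).map (φ ⊵ₗ n ≫ H.ieval n S) ≫ κ) ▷ dual X) ⊗≫
        ev (dual X) := by
  -- Evaluating on `n` turns `[n, l ≫ c ≫ j]` into composition with `l ≫ c ≫ j` and the lineator of
  -- `[n, -]` into the action of `X^**`.
  have e : (dual (dual X) ◁ φ ≫ H.a (dual (dual X)) n S ≫
      (H.Y n).map (l ≫ c ≫ j)) ⊵ₗ n ≫ H.ieval n S' =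
      ((αₗ _ _ _).hom ≫ dual (dual X) ⊴ₗ (φ ⊵ₗ n ≫ H.ieval n S) ≫ l) ≫ c ≫ j := by
    simp only [MonoidalLeftAction.comp_actionHomLeft, Category.assoc, map_ieval, a_ieval_assoc,
      MonoidalLeftAction.actionHomRight_comp]
    rw [← reassoc_of% assoc_natM]
  -- The part up to `l`, seen through `κW`: by `hl` the factor `X^**` is left untouched beside the
  -- pairing of `φ`.
  have e' : H.a (dual (dual X) ⊗ A) m n ≫
      (H.Y m).map ((αₗ _ _ _).hom ≫ dual (dual X) ⊴ₗ (φ ⊵ₗ n ≫ H.ieval n S) ≫ l) ≫ κW =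
      (α_ _ _ _).hom ≫ dual (dual X) ◁ (H.a A m n ≫ (H.Y m).map (φ ⊵ₗ n ≫ H.ieval n S) ≫ κ) ≫
        (ρ_ _).hom ≫ (λ_ _).inv := by
    rw [Functor.map_comp, Functor.map_comp (H.Y m) (_ ⊴ₗ _)]
    simp only [Category.assoc]
    rw [reassoc_of% H.a_tensor, reassoc_of% H.a_map, hl]
    simp only [MonoidalCategory.whiskerLeft_comp, Category.assoc]
  rw [e, ← reassoc_of% H.a_b X (dual X)]
  -- From here on, this morphism matters only through `e'`. Naturality of `[m, -] ⊗ X^* ≅ [X ▷ m,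
  -- -]` moves it and `c` from `[X ▷ m, -]` to `[m, -] ⊗ X^*`, where `hj` and `hc` apply.
  generalize (αₗ _ _ _).hom ≫ dual (dual X) ⊴ₗ (φ ⊵ₗ n ≫ H.ieval n S) ≫ l = f at e'
  rw [Functor.map_comp, Functor.map_comp, Category.assoc, Category.assoc,
    ← reassoc_of% H.b_natural X (dual X) m f, ← reassoc_of% H.b_natural X (dual X) m c, hj, hc,
    ← comp_whiskerRight_assoc, ← comp_whiskerRight_assoc, Category.assoc, e', contr, ev]
  monoidal

omit [RigidCategory C] in
-- The right square in transposed form. The isomorphism `[n, S] ⊗ X' ≅ [X ▷ n, S]` is defined by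
-- contracting `X'` with `X` before evaluating, and the module structure of `[m, -]` moves that
-- contraction in front of the pairing of `φ`.
theorem InternalHom.pairing_right (H : InternalHom C M) (X X' : C) [ExactPairing X X'] (A : C)
    (m n : M) {S : M} {κ : H.hom m S ⟶ 𝟙_ C} (φ : A ⟶ H.hom n S) :
    (A ⊗ X') ◁ H.a X m n ≫ H.a (A ⊗ X') m (X ⊙ₗ n) ≫
      (H.Y m).map ((φ ▷ X' ≫ (H.b X X' n S).hom) ⊵ₗ (X ⊙ₗ n) ≫ H.ieval (X ⊙ₗ n) S) ≫ κ =
    𝟙 _ ⊗≫ A ◁ (ε_ X X' ▷ H.hom m n) ⊗≫ H.a A m n ≫ (H.Y m).map (φ ⊵ₗ n ≫ H.ieval n S) ≫ κ := by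
  have e : (φ ▷ X' ≫ (H.b X X' n S).hom) ⊵ₗ (X ⊙ₗ n) ≫ H.ieval (X ⊙ₗ n) S =
      (αₗ _ _ _).inv ≫ contr X X' A ⊵ₗ n ≫ φ ⊵ₗ n ≫ H.ieval n S := by
    rw [MonoidalLeftAction.comp_actionHomLeft, Category.assoc, b_ieval,
      reassoc_of% contrAct_natural, contrAct, Category.assoc]
  have e' : (A ⊗ X') ◁ H.a X m n ≫ H.a (A ⊗ X') m (X ⊙ₗ n) ≫ (H.Y m).map (αₗ _ _ _).inv =
      (α_ _ _ _).inv ≫ H.a ((A ⊗ X') ⊗ X) m n :=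
    μₗ_associativity_inv (H.Y m) (A ⊗ X') X n
  rw [e, Functor.map_comp, Functor.map_comp (H.Y m) (_ ⊵ₗ n), Category.assoc, Category.assoc,
    reassoc_of% e', reassoc_of% H.map_a, contr]
  monoidal

end RelativeSerreModuleStructure

/-! ### The lineator of the composite makes `φ` a bimodule isomorphism. -/

section StandardRelativeSerre

open Functor.LaxLeftLinear MonoidalLeftAction Opposite

variable (k : Type w) [Field k] {C : Type u} [Category.{v} C] [Abelian C] [Linear k C]
  [MonoidalCategory C] [MonoidalPreadditive C] [MonoidalLinear k C] [RigidCategory C]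
  [FiniteTensorCategory k C]
  {M : Type u'} [Category.{v'} M] [Abelian M] [Linear k M] [MonoidalLeftAction C M]
  [ExactModuleCategory k C M] (H : InternalHom C M) (R : RightAdjoints k C M)

/-- The module structure of the composite of the Yoneda functor, of the functor taking right
adjoints, and of evaluation at the unit object, on the standard relative Serre functor. -/
abbrev standardSerreLax : (toTwist (C := C) (standardSerre k H R).functor).LaxLeftLinear C :=
  (yonedaRightAdjointEval k H R).lax

/-- The composite sends `m` to `Y_m^ra(1)` and a morphism to its conjugate at `1`, as `S` does by
definition, so the equality is strict. -/
theorem standardSerre_toModuleFunctor :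
    (standardSerre k H R).toModuleFunctor (standardSerreLax k H R) =
      yonedaRightAdjointEval k H R := rfl

/-- Provides `hl`. The lineator of a right adjoint is defined by its composite with the counit;
naturality of the counit handles `V ⊗ 1 ≅ 1 ⊗ V`, which comes from evaluating at the unit. -/
theorem lineator_serreCounit (V : C) (m : M) :
    H.a V m ((R.ra (H.yonedaObj k m)).obj (𝟙_ C)) ≫
      (H.Y m).map (R.lineator (H.yonedaObj k m) V (𝟙_ C) ≫
        (R.ra (H.yonedaObj k m)).map ((ρ_ V).hom ≫ (λ_ V).inv)) ≫
        R.counit (H.yonedaObj k m) (𝟙_ C ⊗ V) =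
      V ◁ R.counit (H.yonedaObj k m) (𝟙_ C) ≫ (ρ_ V).hom ≫ (λ_ V).inv := by
  have h := R.lineator_counit (H.yonedaObj k m) V (𝟙_ C) =≫ ((ρ_ V).hom ≫ (λ_ V).inv)
  rw [← h, Category.assoc, Category.assoc, ← R.map_counit, ← Functor.map_comp_assoc]
  rfl

theorem standardSerre_left (X : C) (m n : M) :
    dual (dual X) ◁ (serreIso k H R m n).hom ≫
        H.a (dual (dual X)) n ((standardSerreFunctor k H R).obj m) ≫
        (H.Y n).map (twistedLineator (standardSerreLax k H R) X m) =
      (H.dualLeft X m n).hom ≫ (serreIso k H R (X ⊙ₗ m) n).hom := by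
  apply serrePairing_injective
  -- Precomposing with `[m, n] ⊗ X^* ≅ [X ▷ m, n]` cancels the inverse of that isomorphism on both
  -- sides: dualized in `dualLeft`, and inside the Yoneda factor of the lineator.
  rw [← cancel_epi (_ ◁ (H.b X (dual X) m n).hom)]
  have hR : _ ◁ (H.b X (dual X) m n).hom ≫ serrePairing k H R ((H.dualLeft X m n).hom ≫
      (serreIso k H R (X ⊙ₗ m) n).hom) = evTensor (H.hom m n) (dual X) := by
    have h : (H.dualLeft X m n).hom = (dualTensor (H.hom m n) (dual X)).inv ≫
      dualMap (H.b X (dual X) m n).inv := rfl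
    rw [serrePairing_comp, serrePairing_serreIso, h, comp_whiskerRight, Category.assoc,
      dualMap_ev, whisker_exchange_assoc, ← MonoidalCategory.whiskerLeft_comp_assoc, Iso.hom_inv_id,
      MonoidalCategory.whiskerLeft_id, Category.id_comp, dualTensor_inv_ev]
  rw [hR, evTensor, ← serrePairing_serreIso k H R m n]
  -- The lineator of the composite unfolds to `l ≫ c ≫ j`: evaluation at `X^**`, then the adjoint
  -- and Yoneda factors evaluated at `1`.
  refine H.pairing_left X _ m n _
    (l := R.lineator (H.yonedaObj k m) (dual (dual X)) (𝟙_ C) ≫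
        (R.ra (H.yonedaObj k m)).map ((ρ_ _).hom ≫ (λ_ _).inv))
    (c := R.actComp X (H.yonedaObj k m) (𝟙_ C))
    (j := R.conj (H.yonedaAct k X m).inv (𝟙_ C))
    (lineator_serreCounit k H R (dual (dual X)) m)
    (R.actComp_counit X (H.yonedaObj k m) (𝟙_ C)) ?_
  -- The Yoneda factor is the conjugate of `[X ▷ m, -] ≅ [m, -] ⊗ X^*`, so under the counits it
  -- becomes that isomorphism; this is `hj` up to moving it across.
  have h : (H.Y (X ⊙ₗ m)).map (R.conj (H.yonedaAct k X m).inv (𝟙_ C)) ≫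
      serreCounit k H R (X ⊙ₗ m) = (H.b X (dual X) m _).inv ≫
        R.actCounit (H.yonedaObj k m) (dual X) (𝟙_ C) :=
    R.conj_counit (H.yonedaAct k X m).inv (𝟙_ C)
  exact (Iso.eq_inv_comp _).1 h

theorem standardSerre_right (X : C) (m n : M) :
    (serreIso k H R m n).hom ▷ X ≫
        (H.b (ᘁX) X n ((standardSerreFunctor k H R).obj m)).hom =
      (H.dualRight X m n).hom ≫ (serreIso k H R m ((ᘁX) ⊙ₗ n)).hom := by
  apply serrePairing_injective
  -- Precomposing with `^*X ⊗ [m, n] ≅ [m, ^*X ▷ n]` cancels the dual of its inverse in `dualRight`.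
  rw [← cancel_epi (_ ◁ H.a (ᘁX) m n)]
  let i : dual (H.hom m n) ⊗ X ≅ dual ((ᘁX) ⊗ H.hom m n) :=
    rightDualIso ExactPairing.tensor (dualPairing _)
  have h : (H.dualRight X m n).hom = i.hom ≫ dualMap (inv (H.a (ᘁX) m n)) := rfl
  -- The comparison of two duals of `^*X ⊗ [m, n]` intertwines their evaluations; for `[m, n]^* ⊗ X`
  -- the evaluation is the nested one.
  have hi : i.hom ▷ ((ᘁX) ⊗ H.hom m n) ≫ ev ((ᘁX) ⊗ H.hom m n) =
      𝟙 _ ⊗≫ dual (H.hom m n) ◁ (ε_ (ᘁX) X ▷ H.hom m n) ⊗≫ ev (H.hom m n) := by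
    refine (@rightAdjointMate_comp_evaluation C _ _ ((ᘁX) ⊗ H.hom m n) ((ᘁX) ⊗ H.hom m n)
      ⟨dual ((ᘁX) ⊗ H.hom m n)⟩ ⟨dual (H.hom m n) ⊗ X⟩ (𝟙 _)).trans ?_
    simp only [MonoidalCategory.whiskerLeft_id, Category.id_comp]
    rfl
  rw [serrePairing_comp k H R (H.dualRight X m n).hom, serrePairing_serreIso, h,
    comp_whiskerRight, Category.assoc, dualMap_ev,
    whisker_exchange_assoc, ← MonoidalCategory.whiskerLeft_comp_assoc, IsIso.hom_inv_id,
    MonoidalCategory.whiskerLeft_id, Category.id_comp, hi, ← serrePairing_serreIso k H R m n]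
  exact H.pairing_right (ᘁX) X _ m n _

theorem standardSerre_isBimoduleIso :
    (standardSerre k H R).IsBimoduleIso (standardSerreLax k H R) where
  left := standardSerre_left k H R
  right := standardSerre_right k H R

end StandardRelativeSerre

end RelSerre

end

/-! ### The main theorem. -/

theorem mainTheorem9 {k : Type w} [Field k] [IsAlgClosed k]
    {C : Type u} [Category.{v} C] [Abelian C] [Linear k C] [MonoidalCategory C]
    [MonoidalPreadditive C] [MonoidalLinear k C] [RigidCategory C]
    [RelSerre.FiniteTensorCategory k C]
    {M : Type u'} [Category.{v'} M] [Abelian M] [Linear k M] [MonoidalLeftAction C M]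
    [RelSerre.ExactModuleCategory k C M] :
    Nonempty (RelSerre.InternalHom C M) ∧ Nonempty (RelSerre.RightAdjoints k C M) ∧
      ∀ (H : RelSerre.InternalHom C M) (R : RelSerre.RightAdjoints k C M),
        (∃! s : (RelSerre.toTwist (C := C)
            (RelSerre.standardSerre k H R).functor).LaxLeftLinear C,
          (RelSerre.standardSerre k H R).IsBimoduleIso s) ∧
        ∀ s : (RelSerre.toTwist (C := C)
            (RelSerre.standardSerre k H R).functor).LaxLeftLinear C,
          (RelSerre.standardSerre k H R).IsBimoduleIso s →
            (RelSerre.standardSerre k H R).toModuleFunctor s =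
              RelSerre.yonedaRightAdjointEval k H R := by
  refine ⟨RelSerre.nonempty_internalHom k, RelSerre.nonempty_rightAdjoints k, fun H R => ?_⟩
  have h := RelSerre.standardSerre_isBimoduleIso k H R
  refine ⟨⟨RelSerre.standardSerreLax k H R, h, fun s hs => hs.unique h⟩, fun s hs => ?_⟩
  -- Uniqueness identifies an arbitrary compatible structure with the one transported from the
  -- composite.
  rw [hs.unique h]
  exact RelSerre.standardSerre_toModuleFunctor k H R
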